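/- Let $T$ be a compact metric space, let $\mathbb C^+$ be the set of non-negative continuous functions on $T$ with the uniform norm $\|x\|=\sup_{t\in T}x(t)$, and let $\mathbb C_0^+=\mathbb C^+\setminus\{0\}$. Let $\overline{\mathbb C}_0^+=(0,+\infty]\times\{s\in\mathbb C^+:\|s\|=1\}$, with the metric $d((r_1,s_1),(r_2,s_2))=|1/r_1-1/r_2|+\|s_1-s_2\|$ (where $1/\infty=0$); identify $\mathbb C_0^+$ with the points of finite radius $r<\infty$ of $\overline{\mathbb C}_0^+$ through $x\mapsto(\|x\|,x/\|x\|)$. A Borel measure on a metric space is boundedly finite if it is finite on bounded Borel sets; boundedly finite measures $\mu_n$ converge $\sharp$-weakly to a boundedly finite measure $\nu$ if $\int f\,d\mu_n\to\int f\,d\nu$ for every bounded continuous function $f$ with bounded support. For each $n\ge 1$ let $X_n$ be a random element of $\mathbb C^+$ and let $(X_{in})_{i\ge1}$ be independent copies of $X_n$. Assume that the measures $n\,\mathbb P[X_n\in\cdot\,]$, restricted to $\mathbb C_0^+$ and regarded as measures on $\overline{\mathbb C}_0^+$, converge $\sharp$-weakly to a boundedly finite measure $\nu$ on $\overline{\mathbb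 C}_0^+$, and that $\nu(\overline{\mathbb C}_0^+\setminus\mathbb C_0^+)=0$. Let $\sum_i\delta_{(Y_i,U_i)}$ (a finite or countable sum) be a Poisson point process on $\mathbb C_0^+\times[0,\infty)$ with intensity $\nu\otimes\ell$, where $\ell$ is the Lebesgue measure on $[0,\infty)$; here boundedness in $\mathbb C_0^+$ is understood for $d$, so that only finitely many points satisfy $\|Y_i\|\ge\varepsilon$ and $U_i\le K$, for all $\varepsilon,K>0$. Then the formulas $$\tilde M_n(u,t)=\max_{1\le i\le[nu]}X_{in}(t),\qquad \tilde M(u,t)=\sup_i\,Y_i(t)\,\mathbf 1_{[U_i,\infty)}(u),\qquad u\ge0,\ t\in T$$ (a maximum or supremum over the empty set being $0$) define random elements $\tilde M_n$, $\tilde M$ of the Skorokhod space $\mathbb D([0,\infty),\mathbb C^+)$ of càdlàg functions with the $J_1$ topology, and $\tilde M_n$ converges weakly to $\tilde M$ in $\mathbb D([0,\infty),\mathbb C^+)$ as $n\to\infty$. -/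

import Mathlib

open MeasureTheory ProbabilityTheory Filter Topology Set
open scoped NNReal ENNReal BoundedContinuousFunction

noncomputable section

/-! ### Boundedly finite measures and point processes on a metric space -/

section PointProcesses

variable {E : Type*} [PseudoMetricSpace E] [MeasurableSpace E]

/-- A measure is boundedly finite if every bounded Borel set has finite measure. -/
def BoundedlyFinite (μ : Measure E) : Prop :=
  ∀ B : Set E, MeasurableSet B → Bornology.IsBounded B → μ B < ∞

/-- `♯`-weak convergence of a sequence of boundedly finite measures to a boundedly finite measure:
convergence of the integrals of bounded continuous functions with bounded support. -/
structure SharpWeakTendsto (μ : ℕ → Measure E) (ν : Measure E) : Prop where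
  boundedlyFinite : ∀ n, BoundedlyFinite (μ n)
  boundedlyFinite_limit : BoundedlyFinite ν
  tendsto : ∀ f : E →ᵇ ℝ, Bornology.IsBounded (Function.support f) →
    Tendsto (fun n => ∫ x, f x ∂(μ n)) atTop (𝓝 (∫ x, f x ∂ν))

/-- A boundedly finite point measure: the sum of the Dirac masses at a finite or countable family
of points, only finitely many of which lie in any given bounded set. -/
def IsPointMeasure (μ : Measure E) : Prop :=
  ∃ (I : Set ℕ) (x : I → E), μ = Measure.sum (fun i => Measure.dirac (x i)) ∧
    ∀ B : Set E, Bornology.IsBounded B → {i | x i ∈ B}.Finite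

/-- `N` is a Poisson point process with intensity `μ` on the probability space `(Ω, P)`: a random
boundedly finite point measure such that the number of points in a bounded Borel set `B` is
Poisson distributed with mean `μ B`, and such that the numbers of points in finitely many pairwise
disjoint bounded Borel sets are independent. -/
structure IsPoissonPointProcess {Ω : Type*} [MeasurableSpace Ω] (N : Ω → Measure E)
    (μ : Measure E) (P : Measure Ω) : Prop where
  measurable : Measurable N
  isPointMeasure : ∀ ω, IsPointMeasure (N ω)
  map_apply : ∀ B : Set E, MeasurableSet B → Bornology.IsBounded B →
    P.map (fun ω => N ω B) =
      (poissonMeasure (μ B).toNNReal).map (fun k : ℕ => (k : ℝ≥0∞))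
  iIndepFun : ∀ (k : ℕ) (B : Fin k → Set E),
    (∀ i, MeasurableSet (B i)) → (∀ i, Bornology.IsBounded (B i)) →
    Pairwise (fun i j => Disjoint (B i) (B j)) →
    ProbabilityTheory.iIndepFun (fun i ω => N ω (B i)) P

end PointProcesses

/-- Lebesgue measure on `[0,∞)`. -/
def lebesgueHalfLine : Measure ℝ≥0 := (volume : Measure ℝ).comap (fun u : ℝ≥0 => (u : ℝ))

/-! ### The Skorokhod space with the `J₁` topology -/

/-- The Skorokhod space `D([0,∞), E)` of right-continuous functions with left limits. -/
structure SkorokhodSpace (E : Type*) [TopologicalSpace E] where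
  toFun : ℝ≥0 → E
  rightContinuous : ∀ u, ContinuousWithinAt toFun (Ici u) u
  leftLimit : ∀ u, ∃ l, Tendsto toFun (𝓝[<] u) (𝓝 l)

instance {E : Type*} [TopologicalSpace E] : CoeFun (SkorokhodSpace E) (fun _ => ℝ≥0 → E) :=
  ⟨SkorokhodSpace.toFun⟩

namespace SkorokhodSpace

variable {E : Type*} [PseudoMetricSpace E]

/-- Basic `J₁`-neighbourhood of `x`: the `y` that are `ε`-close to `x` on the time interval `[0, K]`
after a change of time `Λ` (an increasing bijection of `[0,∞)`) which is itself `ε`-close to the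
identity on `[0, K]`. -/
def basicNhd (x : SkorokhodSpace E) (K : ℝ≥0) (ε : ℝ) : Set (SkorokhodSpace E) :=
  {y | ∃ Λ : ℝ≥0 ≃o ℝ≥0, ∀ u ≤ K, dist (Λ u) u ≤ ε ∧ dist (y u) (x (Λ u)) ≤ ε}

theorem basicNhd_anti (x : SkorokhodSpace E) {K K' : ℝ≥0} {ε ε' : ℝ} (hK : K ≤ K') (hε : ε' ≤ ε) :
    x.basicNhd K' ε' ⊆ x.basicNhd K ε := by
  rintro y ⟨Λ, hΛ⟩
  exact ⟨Λ, fun u hu => ⟨(hΛ u (hu.trans hK)).1.trans hε, (hΛ u (hu.trans hK)).2.trans hε⟩⟩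

/-- The `J₁` topology. A sequence `xₙ` converges to `x` if and only if for all `K` there are
changes of time `Λₙ` such that `Λₙ u - u` and `dist (xₙ u) (x (Λₙ u))` tend to `0` uniformly
for `u ≤ K`. -/
instance : TopologicalSpace (SkorokhodSpace E) where
  IsOpen s := ∀ x ∈ s, ∃ K : ℝ≥0, ∃ ε > 0, x.basicNhd K ε ⊆ s
  isOpen_univ := fun _ _ => ⟨0, 1, one_pos, subset_univ _⟩
  isOpen_inter := by
    rintro s t hs ht x ⟨hxs, hxt⟩
    obtain ⟨K, ε, hε, h⟩ := hs x hxs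
    obtain ⟨K', ε', hε', h'⟩ := ht x hxt
    exact ⟨max K K', min ε ε', lt_min hε hε', subset_inter
      ((x.basicNhd_anti (le_max_left _ _) (min_le_left _ _)).trans h)
      ((x.basicNhd_anti (le_max_right _ _) (min_le_right _ _)).trans h')⟩
  isOpen_sUnion := by
    rintro S hS x ⟨s, hs, hxs⟩
    obtain ⟨K, ε, hε, h⟩ := hS s hs x hxs
    exact ⟨K, ε, hε, h.trans (subset_sUnion_of_mem hs)⟩

instance : MeasurableSpace (SkorokhodSpace E) := borel _

instance : BorelSpace (SkorokhodSpace E) := ⟨rfl⟩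

end SkorokhodSpace

/-! ### Non-negative continuous functions and polar coordinates -/

section Cone

/-- The space `C⁺(T)` of non-negative continuous functions, with the uniform distance. -/
abbrev CPlus (T : Type*) [TopologicalSpace T] := C(T, ℝ≥0)

instance {T : Type*} [TopologicalSpace T] : MeasurableSpace (CPlus T) := borel _

instance {T : Type*} [TopologicalSpace T] : BorelSpace (CPlus T) := ⟨rfl⟩

/-- `C₀⁺(T) = C⁺(T) \ {0}`. -/
abbrev CPlusZero (T : Type*) [TopologicalSpace T] := {x : CPlus T // x ≠ 0}

variable {T : Type*} [MetricSpace T] [CompactSpace T]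

/-- The uniform norm `‖x‖ = sup_t x(t)` on `C⁺(T)`. -/
def supNorm (x : CPlus T) : ℝ≥0 := nndist x 0

theorem supNorm_smul (c : ℝ≥0) (x : CPlus T) : supNorm (c • x) = c * supNorm x := by
  have key : ∀ y : CPlus T, ∀ b : ℝ≥0, supNorm y ≤ b ↔ ∀ t, y t ≤ b := by
    intro y b
    have h : dist y 0 ≤ b ↔ ∀ t, dist (y t) ((0 : C(T, ℝ≥0)) t) ≤ b := ContinuousMap.dist_le b.2
    rw [supNorm, ← NNReal.coe_le_coe, coe_nndist, h]
    simp [NNReal.dist_eq]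
  apply le_antisymm
  · rw [key]
    intro t
    rw [ContinuousMap.smul_apply, smul_eq_mul]
    gcongr
    exact (key x _).1 le_rfl t
  · rcases eq_or_ne c 0 with rfl | hc
    · simp
    · have hc' : 0 < c := pos_iff_ne_zero.2 hc
      rw [← le_div_iff₀' hc', key]
      intro t
      rw [le_div_iff₀' hc']
      exact (key (c • x) _).1 le_rfl t

theorem supNorm_ne_zero {x : CPlus T} (hx : x ≠ 0) : supNorm x ≠ 0 := by
  simpa [supNorm] using hx

variable (T) in
/-- The extended cone `(0,∞] × S` where `S` is the unit sphere of `C⁺(T)`. -/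
@[ext] structure ExtCone where
  radius : ℝ≥0∞
  shape : CPlus T
  radius_ne_zero : radius ≠ 0
  supNorm_shape : supNorm shape = 1

namespace ExtCone

/-- The distance `d((r₁,s₁),(r₂,s₂)) = |1/r₁ - 1/r₂| + ‖s₁ - s₂‖`, with `1/∞ = 0`. -/
instance : MetricSpace (ExtCone T) where
  dist p q := |(p.radius⁻¹).toReal - (q.radius⁻¹).toReal| + dist p.shape q.shape
  dist_self p := by simp
  dist_comm p q := by rw [abs_sub_comm, dist_comm p.shape]
  dist_triangle p q r := by
    have h1 := abs_sub_le (p.radius⁻¹).toReal (q.radius⁻¹).toReal (r.radius⁻¹).toReal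
    have h2 := dist_triangle p.shape q.shape r.shape
    linarith
  eq_of_dist_eq_zero {p q} h := by
    have h1 := abs_nonneg ((p.radius⁻¹).toReal - (q.radius⁻¹).toReal)
    have h2 : 0 ≤ dist p.shape q.shape := dist_nonneg
    have h3 : |(p.radius⁻¹).toReal - (q.radius⁻¹).toReal| = 0 := by linarith
    have h4 : dist p.shape q.shape = 0 := by linarith
    refine ExtCone.ext ?_ (dist_eq_zero.1 h4)
    rw [abs_eq_zero, sub_eq_zero, ENNReal.toReal_eq_toReal_iff'
      (ENNReal.inv_ne_top.2 p.radius_ne_zero) (ENNReal.inv_ne_top.2 q.radius_ne_zero)] at h3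
    exact inv_injective h3

instance : MeasurableSpace (ExtCone T) := borel _

instance : BorelSpace (ExtCone T) := ⟨rfl⟩

/-- The polar decomposition `x ↦ (‖x‖, x / ‖x‖)`, which identifies `C₀⁺(T)` with the set of points
of finite radius. -/
def polar (x : CPlusZero T) : ExtCone T where
  radius := supNorm x.1
  shape := (supNorm x.1)⁻¹ • x.1
  radius_ne_zero := by simpa using supNorm_ne_zero x.2
  supNorm_shape := by rw [supNorm_smul, inv_mul_cancel₀ (supNorm_ne_zero x.2)]

/-- The measure on the extended cone induced by a measure `μ` on `C⁺(T)`: restrict `μ` to `C₀⁺(T)`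
and transport it by the polar decomposition. -/
def inducedMeasure (μ : Measure (CPlus T)) : Measure (ExtCone T) :=
  (μ.comap (Subtype.val : CPlusZero T → CPlus T)).map polar

end ExtCone

end Cone

end

/-!
Cut the part `‖w‖ ≥ ε` of the cone into finitely many small continuity sets of `ν`, and the time
axis into short slabs. When no slab contains two points of norm at least `ε`, the finite set of
occupied cells determines the path up to a small `J₁` distance: a change of time moves each of
these points to the end of its slab, and the smaller points change the supremum by less than `ε`.
For the independent samples as for the Poisson process, the law of the set of occupied cells is
determined by inclusion-exclusion from the void probabilities, and these converge, as
`(1 - p)ᵐ → exp (-c)` when `m p → c`. The exceptional event is controlled for the Poisson process,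
hence also, being described by the occupied cells, for the samples.
-/

/-! ### Convergence in distribution by approximation -/

section Approximation

theorem abs_integral_comp_sub_le {Ω D : Type*} [MeasurableSpace Ω] {μ : Measure Ω}
    [IsProbabilityMeasure μ] [PseudoMetricSpace D] [MeasurableSpace D] [BorelSpace D]
    {X Z : Ω → D} (hX : AEMeasurable X μ) (hZ : AEMeasurable Z μ) {f : D → ℝ} {C : ℝ} {B : ℝ≥0}
    (hC : ∀ x y, dist (f x) (f y) ≤ C) (hf : LipschitzWith B f) {δ : ℝ} (hδ : 0 ≤ δ) :
    |∫ ω, f (X ω) ∂μ - ∫ ω, f (Z ω) ∂μ| ≤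
      B * δ + C * μ.real {ω | δ < dist (X ω) (Z ω)} := by
  set s := toMeasurable μ {ω | δ < dist (X ω) (Z ω)} with hs
  have hsm : MeasurableSet s := measurableSet_toMeasurable _ _
  obtain ⟨ω₀⟩ : Nonempty Ω := nonempty_of_isProbabilityMeasure μ
  have hint : ∀ V : Ω → D, AEMeasurable V μ → Integrable (fun ω => f (V ω)) μ := fun V hV => by
    refine Integrable.of_bound
      (hf.continuous.measurable.comp_aemeasurable hV).aestronglyMeasurable (C + ‖f (V ω₀)‖)
      (Eventually.of_forall fun ω => ?_)
    linarith [hC (V ω) (V ω₀), norm_sub_norm_le (f (V ω)) (f (V ω₀)),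
      dist_eq_norm (f (V ω)) (f (V ω₀))]
  have hpt : ∀ ω, |f (X ω) - f (Z ω)| ≤ B * δ + s.indicator (fun _ => C) ω := fun ω => by
    rw [← Real.dist_eq]
    by_cases hω : ω ∈ s
    · rw [indicator_of_mem hω]
      exact (hC _ _).trans (le_add_of_nonneg_left (by positivity))
    · rw [indicator_of_notMem hω, add_zero]
      have hclose : dist (X ω) (Z ω) ≤ δ :=
        not_lt.1 fun h => hω (subset_toMeasurable _ _ h)
      exact (hf.dist_le_mul _ _).trans (by gcongr)
  have hbad : Integrable (s.indicator fun _ => C) μ := (integrable_const C).indicator hsm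
  calc |∫ ω, f (X ω) ∂μ - ∫ ω, f (Z ω) ∂μ|
      = |∫ ω, (f (X ω) - f (Z ω)) ∂μ| := by rw [integral_sub (hint X hX) (hint Z hZ)]
    _ ≤ ∫ ω, |f (X ω) - f (Z ω)| ∂μ := abs_integral_le_integral_abs
    _ ≤ ∫ ω, (B * δ + s.indicator (fun _ => C) ω) ∂μ :=
        integral_mono ((hint X hX).sub (hint Z hZ)).abs ((integrable_const _).add hbad) hpt
    _ = B * δ + C * μ.real {ω | δ < dist (X ω) (Z ω)} := by
        rw [integral_add (integrable_const _) hbad, integral_const, probReal_univ, one_smul,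
          integral_indicator_const C hsm, smul_eq_mul, mul_comm C, hs, measureReal_def,
          measure_toMeasurable, measureReal_def]

theorem aemeasurable_of_approx {Ω D : Type*} [MeasurableSpace Ω] {μ : Measure Ω}
    [IsFiniteMeasure μ] [PseudoMetricSpace D] [MeasurableSpace D] [BorelSpace D] {X : Ω → D}
    (h : ∀ δ > 0, ∃ Z : Ω → D, AEMeasurable Z μ ∧ μ.real {ω | δ < dist (X ω) (Z ω)} ≤ δ) :
    AEMeasurable X μ := by
  choose Z hZ hδ using fun m : ℕ => h (1 / (m + 1)) Nat.one_div_pos_of_nat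
  have hlim : TendstoInMeasure μ Z atTop X := by
    refine tendstoInMeasure_iff_measureReal_dist.2 fun ε hε => ?_
    refine squeeze_zero' (Eventually.of_forall fun _ => measureReal_nonneg) ?_
      tendsto_one_div_add_atTop_nhds_zero_nat
    filter_upwards [tendsto_one_div_add_atTop_nhds_zero_nat.eventually_lt_const hε] with m hm
    refine (measureReal_mono fun ω hω => ?_).trans (hδ m)
    exact hm.trans_le (le_of_le_of_eq hω (dist_comm _ _))
  obtain ⟨ns, -, hns⟩ := hlim.exists_seq_tendsto_ae
  exact aemeasurable_of_tendsto_metrizable_ae atTop (fun i => hZ (ns i)) hns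

variable {ι : Type*} {l : Filter ι} {Ω : ι → Type*} [∀ n, MeasurableSpace (Ω n)]
  {P : ∀ n, Measure (Ω n)} [∀ n, IsProbabilityMeasure (P n)]
  {Ω' : Type*} [MeasurableSpace Ω'] {P' : Measure Ω'} [IsProbabilityMeasure P']

theorem tendstoInDistribution_of_approx [l.IsCountablyGenerated] {D : Type*}
    [PseudoMetricSpace D] [MeasurableSpace D] [BorelSpace D] {X : ∀ n, Ω n → D} {X' : Ω' → D}
    (hX : ∀ n, AEMeasurable (X n) (P n))
    (H : ∀ δ > 0, ∃ (Z : ∀ n, Ω n → D) (Z' : Ω' → D), TendstoInDistribution Z l Z' P P' ∧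
      (∀ᶠ n in l, (P n).real {ω | δ < dist (X n ω) (Z n ω)} ≤ δ) ∧
      P'.real {ω | δ < dist (X' ω) (Z' ω)} ≤ δ) :
    TendstoInDistribution X l X' P P' := by
  have hX' : AEMeasurable X' P' := aemeasurable_of_approx fun δ hδ =>
    let ⟨_, Z', hZ, _, h'⟩ := H δ hδ
    ⟨Z', hZ.aemeasurable_limit, h'⟩
  refine ⟨hX, hX', tendsto_iff_forall_lipschitz_integral_tendsto.2 ?_⟩
  rintro f ⟨C, hC⟩ ⟨B, hf⟩
  have hfm : Measurable f := hf.continuous.measurable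
  simp only [ProbabilityMeasure.coe_mk, integral_map (hX _) hfm.aestronglyMeasurable,
    integral_map hX' hfm.aestronglyMeasurable]
  obtain ⟨ω₀⟩ : Nonempty Ω' := nonempty_of_isProbabilityMeasure P'
  have hC0 : 0 ≤ C := dist_nonneg.trans (hC (X' ω₀) (X' ω₀))
  refine Metric.tendsto_nhds.2 fun η hη => ?_
  obtain ⟨δ, hδ, hδη⟩ : ∃ δ > 0, B * δ + C * δ ≤ η / 3 := by
    refine ⟨η / 3 / (B + C + 1), by positivity, ?_⟩
    rw [← add_mul, mul_div_assoc', div_le_iff₀ (by positivity)]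
    nlinarith
  obtain ⟨Z, Z', hZ, hn, h'⟩ := H δ hδ
  have hZlim := tendsto_iff_forall_lipschitz_integral_tendsto.1 hZ.tendsto f ⟨C, hC⟩ ⟨B, hf⟩
  simp only [ProbabilityMeasure.coe_mk,
    integral_map (hZ.forall_aemeasurable _) hfm.aestronglyMeasurable,
    integral_map hZ.aemeasurable_limit hfm.aestronglyMeasurable] at hZlim
  have hlim := abs_integral_comp_sub_le hX' hZ.aemeasurable_limit hC hf hδ.le
  filter_upwards [hn, Metric.tendsto_nhds.1 hZlim (η / 3) (by positivity)] with n hn hZn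
  have hXn := abs_integral_comp_sub_le (hX n) (hZ.forall_aemeasurable n) hC hf hδ.le
  rw [← Real.dist_eq] at hXn hlim
  linarith [dist_triangle4_right (∫ ω, f (X n ω) ∂(P n)) (∫ ω, f (X' ω) ∂P')
    (∫ ω, f (Z n ω) ∂(P n)) (∫ ω, f (Z' ω) ∂P'), mul_le_mul_of_nonneg_left hn hC0,
    mul_le_mul_of_nonneg_left h' hC0]

end Approximation

/-! ### Finite-valued random variables -/

section FiniteValued

variable {Ω : Type*} [MeasurableSpace Ω] {μ : Measure Ω}

theorem integral_map_comp_eq_sum [IsFiniteMeasure μ] {F D : Type*} [Fintype F]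
    [MeasurableSpace F] [DiscreteMeasurableSpace F] [MeasurableSpace D] {ξ : Ω → F}
    (hξ : AEMeasurable ξ μ) (z : F → D) {f : D → ℝ} (hf : Measurable f) :
    ∫ x, f x ∂(μ.map fun ω => z (ξ ω)) = ∑ S, μ.real {ω | ξ ω = S} * f (z S) := by
  have hz : Measurable z := measurable_of_countable z
  have hzξ : AEMeasurable (fun ω => z (ξ ω)) μ := hz.comp_aemeasurable hξ
  rw [integral_map hzξ hf.aestronglyMeasurable,
    ← integral_map (f := fun S => f (z S)) hξ (hf.comp hz).aestronglyMeasurable,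
    integral_fintype Integrable.of_finite]
  refine Finset.sum_congr rfl fun S _ => ?_
  rw [map_measureReal_apply_of_aemeasurable hξ (MeasurableSet.singleton S), smul_eq_mul]
  rfl

theorem measureReal_comp_eq_sum [IsFiniteMeasure μ] {F : Type*} [Fintype F] [MeasurableSpace F]
    [MeasurableSingletonClass F] {ξ : Ω → F} (hξ : AEMeasurable ξ μ) (p : F → Prop)
    [DecidablePred p] : μ.real {ω | p (ξ ω)} = ∑ S with p S, μ.real {ω | ξ ω = S} := by
  have hunion : {ω | p (ξ ω)} = ⋃ S ∈ Finset.univ.filter p, {ω | ξ ω = S} := by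
    ext ω
    simp
  have hmeas (S : F) : NullMeasurableSet {ω | ξ ω = S} μ :=
    hξ.nullMeasurableSet_preimage (MeasurableSet.singleton S)
  rw [hunion, measureReal_biUnion_finset₀ _ fun S _ => hmeas S]
  intro S _ S' _ hne
  exact Disjoint.aedisjoint (Set.disjoint_left.2 fun ω h h' => hne (h.symm.trans h'))

theorem measureReal_eq_sub_sum_ssubset [IsFiniteMeasure μ] {κ : Type*} [Finite κ]
    [Fintype (Set κ)] [DecidableLT (Set κ)] {ξ : Ω → Set κ}
    (hξ : AEMeasurable ξ μ) (S : Set κ) :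
    μ.real {ω | ξ ω = S} = μ.real {ω | ξ ω ⊆ S} - ∑ R with R < S, μ.real {ω | ξ ω = R} := by
  classical
  have hinsert : Finset.univ.filter (· ⊆ S) = insert S (Finset.univ.filter (· < S)) := by
    ext R
    simpa using le_iff_eq_or_lt
  rw [measureReal_comp_eq_sum hξ (· ⊆ S), hinsert, Finset.sum_insert (by simp),
    add_sub_cancel_right]

variable {ι : Type*} {l : Filter ι} {Ω : ι → Type*} [∀ n, MeasurableSpace (Ω n)]
  {P : ∀ n, Measure (Ω n)} [∀ n, IsProbabilityMeasure (P n)]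
  {Ω' : Type*} [MeasurableSpace Ω'] {P' : Measure Ω'} [IsProbabilityMeasure P']

theorem tendstoInDistribution_comp_of_finite {F D : Type*} [Finite F] [MeasurableSpace F]
    [DiscreteMeasurableSpace F] [TopologicalSpace D] [MeasurableSpace D] [OpensMeasurableSpace D]
    {ξ : ∀ n, Ω n → F} {ξ' : Ω' → F} (hξ : ∀ n, AEMeasurable (ξ n) (P n))
    (hξ' : AEMeasurable ξ' P')
    (h : ∀ S, Tendsto (fun n => (P n).real {ω | ξ n ω = S}) l (𝓝 (P'.real {ω | ξ' ω = S})))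
    (z : F → D) :
    TendstoInDistribution (fun n ω => z (ξ n ω)) l (fun ω => z (ξ' ω)) P P' := by
  have := Fintype.ofFinite F
  have hz : Measurable z := measurable_of_countable z
  refine ⟨fun n => hz.comp_aemeasurable (hξ n), hz.comp_aemeasurable hξ',
    ProbabilityMeasure.tendsto_iff_forall_integral_tendsto.2 fun f => ?_⟩
  simp only [ProbabilityMeasure.coe_mk,
    integral_map_comp_eq_sum (hξ _) z f.continuous.measurable,
    integral_map_comp_eq_sum hξ' z f.continuous.measurable]
  exact tendsto_finsetSum _ fun S _ => (h S).mul_const _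

theorem tendsto_measureReal_comp_of_finite {F : Type*} [Finite F] [MeasurableSpace F]
    [MeasurableSingletonClass F] {ξ : ∀ n, Ω n → F} {ξ' : Ω' → F}
    (hξ : ∀ n, AEMeasurable (ξ n) (P n)) (hξ' : AEMeasurable ξ' P')
    (h : ∀ S, Tendsto (fun n => (P n).real {ω | ξ n ω = S}) l (𝓝 (P'.real {ω | ξ' ω = S})))
    (p : F → Prop) :
    Tendsto (fun n => (P n).real {ω | p (ξ n ω)}) l (𝓝 (P'.real {ω | p (ξ' ω)})) := by
  classical
  have := Fintype.ofFinite F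
  simp only [measureReal_comp_eq_sum (hξ _) p, measureReal_comp_eq_sum hξ' p]
  exact tendsto_finsetSum _ fun S _ => h S

theorem tendsto_measureReal_eq_of_subset {κ : Type*} [Finite κ] {ξ : ∀ n, Ω n → Set κ}
    {ξ' : Ω' → Set κ} (hξ : ∀ n, AEMeasurable (ξ n) (P n)) (hξ' : AEMeasurable ξ' P')
    (h : ∀ S, Tendsto (fun n => (P n).real {ω | ξ n ω ⊆ S}) l (𝓝 (P'.real {ω | ξ' ω ⊆ S})))
    (S : Set κ) :
    Tendsto (fun n => (P n).real {ω | ξ n ω = S}) l (𝓝 (P'.real {ω | ξ' ω = S})) := by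
  classical
  have := Fintype.ofFinite (Set κ)
  induction S using WellFoundedLT.induction with
  | ind S ih =>
    simp only [measureReal_eq_sub_sum_ssubset (hξ _) S, measureReal_eq_sub_sum_ssubset hξ' S]
    exact (h S).sub (tendsto_finsetSum _ fun R hR => ih R (Finset.mem_filter_univ R |>.1 hR))

end FiniteValued

/-! ### The `J₁` uniform structure -/

namespace SkorokhodSpace

variable {E : Type*} [PseudoMetricSpace E]

section Entourages

variable {x y z : SkorokhodSpace E} {K : ℝ≥0} {δ ε : ℝ}

theorem self_mem_basicNhd (x : SkorokhodSpace E) (K : ℝ≥0) (hε : 0 ≤ ε) : x ∈ x.basicNhd K ε :=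
  ⟨OrderIso.refl _, fun _ _ => by simpa using hε⟩

theorem basicNhd_symm (hε : ε ≤ 1) (h : y ∈ x.basicNhd (K + 1) ε) : x ∈ y.basicNhd K ε := by
  obtain ⟨Λ, hΛ⟩ := h
  refine ⟨Λ.symm, fun v hv => ?_⟩
  have hle : Λ.symm v ≤ K + 1 := by
    have hend := abs_le.1 ((NNReal.dist_eq _ _).symm.trans_le (hΛ (K + 1) le_rfl).1)
    have : (v : ℝ) ≤ K := hv
    refine Λ.symm_apply_le.2 (NNReal.coe_le_coe.1 ?_)
    push_cast at hend ⊢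
    linarith
  simpa only [Λ.apply_symm_apply, dist_comm] using hΛ _ hle

theorem basicNhd_trans (hδ : δ ≤ 1) (hxy : y ∈ x.basicNhd (K + 1) ε) (hyz : z ∈ y.basicNhd K δ) :
    z ∈ x.basicNhd K (ε + δ) := by
  obtain ⟨Λ, hΛ⟩ := hxy
  obtain ⟨Λ', hΛ'⟩ := hyz
  refine ⟨Λ'.trans Λ, fun u hu => ?_⟩
  have h' := hΛ' u hu
  have hle : Λ' u ≤ K + 1 := by
    have hend := abs_le.1 ((NNReal.dist_eq _ _).symm.trans_le h'.1)
    have : (u : ℝ) ≤ K := hu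
    refine NNReal.coe_le_coe.1 ?_
    push_cast
    linarith
  have h := hΛ _ hle
  rw [OrderIso.trans_apply]
  exact ⟨(dist_triangle _ (Λ' u) _).trans (add_le_add h.1 h'.1),
    (dist_triangle_left _ _ (y (Λ' u))).trans
      ((add_comm _ _).trans_le (add_le_add h.2 (by rw [dist_comm]; exact h'.2)))⟩

/-- A countable basis of entourages of the `J₁` uniform structure: the pairs `(x, y)` such that `y`
lies in the basic neighbourhood of `x` with time horizon `n` and radius `1 / (n + 1)`. -/
def entourage (n : ℕ) : Set (SkorokhodSpace E × SkorokhodSpace E) :=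
  {p | p.2 ∈ p.1.basicNhd n (1 / (n + 1))}

theorem entourage_anti : Antitone (entourage : ℕ → Set (SkorokhodSpace E × SkorokhodSpace E)) :=
  fun _ _ hmn p hp => p.1.basicNhd_anti (by exact_mod_cast hmn) (Nat.one_div_le_one_div hmn) hp

theorem entourage_symm {n : ℕ} (h : (x, y) ∈ entourage (n + 1)) : (y, x) ∈ entourage n := by
  refine basicNhd_symm (Nat.one_div_le_one_div n.zero_le |>.trans (by norm_num)) ?_
  exact x.basicNhd_anti (by push_cast; exact le_rfl) (Nat.one_div_le_one_div n.le_succ) h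

theorem entourage_comp {n : ℕ} (hxy : (x, y) ∈ entourage (2 * n + 1))
    (hyz : (y, z) ∈ entourage (2 * n + 1)) : (x, z) ∈ entourage n := by
  have hhalf : (1 : ℝ) / ((2 * n + 1 : ℕ) + 1) = 1 / (n + 1) / 2 := by
    push_cast
    field_simp
    ring
  have hle : (n : ℝ≥0) + 1 ≤ (2 * n + 1 : ℕ) := by exact_mod_cast (by omega : n + 1 ≤ 2 * n + 1)
  have hone : (1 : ℝ) / ((2 * n + 1 : ℕ) + 1) ≤ 1 :=
    (Nat.one_div_le_one_div (Nat.zero_le _)).trans (by norm_num)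
  have := basicNhd_trans hone (x.basicNhd_anti hle le_rfl hxy)
    (y.basicNhd_anti (le_self_add.trans hle) le_rfl hyz)
  rwa [hhalf, add_halves] at this

theorem exists_entourage_subset (K : ℝ≥0) (hε : 0 < ε) :
    ∃ n, ∀ x y : SkorokhodSpace E, (x, y) ∈ entourage n → y ∈ x.basicNhd K ε := by
  obtain ⟨n, hn⟩ := exists_nat_one_div_lt hε
  obtain ⟨m, hm⟩ := exists_nat_ge K
  refine ⟨max n m, fun x y h => x.basicNhd_anti (hm.trans ?_) ?_ h⟩
  · exact_mod_cast le_max_right n m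
  · exact (Nat.one_div_le_one_div (le_max_left n m)).trans hn.le

end Entourages

/-- The filter basis made of the sets `entourage n`. -/
def entourageBasis : FilterBasis (SkorokhodSpace E × SkorokhodSpace E) where
  sets := range entourage
  nonempty := range_nonempty _
  inter_sets := by
    rintro _ _ ⟨m, rfl⟩ ⟨n, rfl⟩
    exact ⟨_, ⟨max m n, rfl⟩, subset_inter (entourage_anti (le_max_left _ _))
      (entourage_anti (le_max_right _ _))⟩

/-- The core of the `J₁` uniform structure, generated by the sets `entourage n`. -/
def uniformCore : UniformSpace.Core (SkorokhodSpace E) :=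
  UniformSpace.Core.mkOfBasis entourageBasis
    (by rintro _ ⟨n, rfl⟩ x; exact x.self_mem_basicNhd _ (by positivity))
    (by rintro _ ⟨n, rfl⟩; exact ⟨_, ⟨n + 1, rfl⟩, fun _ hp => entourage_symm hp⟩)
    (by
      rintro _ ⟨n, rfl⟩
      exact ⟨_, ⟨2 * n + 1, rfl⟩, fun _ ⟨_, hxy, hyz⟩ => entourage_comp hxy hyz⟩)

theorem hasBasis_uniformCore :
    (uniformCore (E := E)).uniformity.HasBasis (fun _ : ℕ => True) entourage :=
  ⟨fun _ => entourageBasis.hasBasis.mem_iff.trans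
    ⟨fun ⟨_, ⟨n, hn⟩, h⟩ => ⟨n, trivial, hn ▸ h⟩, fun ⟨n, _, h⟩ => ⟨_, ⟨n, rfl⟩, h⟩⟩⟩

theorem topology_eq_toTopologicalSpace_uniformCore :
    (inferInstance : TopologicalSpace (SkorokhodSpace E)) = uniformCore.toTopologicalSpace := by
  refine TopologicalSpace.ext_iff.2 fun s => ?_
  change (∀ x ∈ s, ∃ K : ℝ≥0, ∃ ε > 0, x.basicNhd K ε ⊆ s) ↔ _
  let _ := (uniformCore (E := E)).toTopologicalSpace
  rw [isOpen_iff_mem_nhds]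
  refine forall₂_congr fun x _ => ?_
  rw [UniformSpace.Core.nhds_toTopologicalSpace, (hasBasis_uniformCore.comap _).mem_iff]
  constructor
  · rintro ⟨K, ε, hε, h⟩
    obtain ⟨n, hn⟩ := exists_entourage_subset (E := E) K hε
    exact ⟨n, trivial, fun y hy => h (hn x y hy)⟩
  · rintro ⟨n, -, h⟩
    exact ⟨n, 1 / (n + 1), by positivity, fun y hy => h hy⟩

/-- The `J₁` uniform structure, which induces the `J₁` topology. -/
abbrev uniformSpace : UniformSpace (SkorokhodSpace E) :=
  UniformSpace.ofCoreEq uniformCore _ topology_eq_toTopologicalSpace_uniformCore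

theorem tendstoInDistribution_of_approx {Ω : ℕ → Type*} [∀ n, MeasurableSpace (Ω n)]
    {P : ∀ n, Measure (Ω n)} [∀ n, IsProbabilityMeasure (P n)] {Ω' : Type*} [MeasurableSpace Ω']
    {P' : Measure Ω'} [IsProbabilityMeasure P'] {X : ∀ n, Ω n → SkorokhodSpace E}
    {X' : Ω' → SkorokhodSpace E} (hX : ∀ n, AEMeasurable (X n) (P n))
    (H : ∀ (K : ℝ≥0) (ε : ℝ), 0 < ε →
      ∃ (Z : ∀ n, Ω n → SkorokhodSpace E) (Z' : Ω' → SkorokhodSpace E),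
        TendstoInDistribution Z atTop Z' P P' ∧
        (∀ᶠ n in atTop, (P n).real {ω | X n ω ∉ (Z n ω).basicNhd K ε} ≤ ε) ∧
        P'.real {ω | X' ω ∉ (Z' ω).basicNhd K ε} ≤ ε) :
    TendstoInDistribution X atTop X' P P' := by
  let _ : UniformSpace (SkorokhodSpace E) := uniformSpace
  have hbasis : (uniformity (SkorokhodSpace E)).HasBasis (fun _ : ℕ => True) entourage :=
    hasBasis_uniformCore
  have := hbasis.isCountablyGenerated
  let _ : PseudoMetricSpace (SkorokhodSpace E) := UniformSpace.pseudoMetricSpace _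
  refine _root_.tendstoInDistribution_of_approx hX fun δ hδ => ?_
  obtain ⟨n, -, hn⟩ := hbasis.mem_iff.1 (Metric.dist_mem_uniformity hδ)
  set r : ℝ := min δ (1 / (n + 1))
  have hfar : ∀ {x z : SkorokhodSpace E}, δ < dist x z → x ∉ z.basicNhd n r := fun hδ hxz => by
    refine hδ.not_ge ((dist_comm _ _).trans_le (le_of_lt ?_))
    exact hn (a := (_, _)) (basicNhd_anti _ le_rfl (min_le_right _ _) hxz)
  obtain ⟨Z, Z', hZ, h, h'⟩ := H n r (by positivity)
  exact ⟨Z, Z', hZ,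
    h.mono fun m hm => (measureReal_mono fun _ => hfar).trans (hm.trans (min_le_left _ _)),
    (measureReal_mono fun _ => hfar).trans (h'.trans (min_le_left _ _))⟩

end SkorokhodSpace

/-! ### Changes of time -/

section TimeChange

variable {p s u h : ℝ≥0}

/-- The function which is the identity up to `p` and has slope `s` afterwards: a building block of
piecewise linear changes of time. -/
noncomputable def kink (p s u : ℝ≥0) : ℝ≥0 := min u p + s * (u - p)

theorem kink_of_le (hu : u ≤ p) : kink p s u = u := by
  simp [kink, hu, tsub_eq_zero_of_le hu]

theorem kink_of_ge (hu : p ≤ u) : kink p s u = p + s * (u - p) := by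
  rw [kink, min_eq_right hu]

theorem monotone_kink (p s : ℝ≥0) : Monotone (kink p s) := fun u v huv => by
  unfold kink
  gcongr

theorem leftInverse_kink_inv (p : ℝ≥0) (hs : s ≠ 0) :
    Function.LeftInverse (kink p s⁻¹) (kink p s) := fun u => by
  rcases le_total u p with hu | hu
  · rw [kink_of_le hu, kink_of_le hu]
  · rw [kink_of_ge hu, kink_of_ge le_self_add, add_tsub_cancel_left, inv_mul_cancel_left₀ hs,
      add_tsub_cancel_of_le hu]

/-- The function `kink p s` as a change of time. -/
noncomputable def kinkIso (p s : ℝ≥0) (hs : s ≠ 0) : ℝ≥0 ≃o ℝ≥0 :=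
  Equiv.toOrderIso
    { toFun := kink p s
      invFun := kink p s⁻¹
      left_inv := leftInverse_kink_inv p hs
      right_inv := fun u => by
        simpa only [inv_inv] using leftInverse_kink_inv p (inv_ne_zero hs) u }
    (monotone_kink p s) (monotone_kink p s⁻¹)

theorem exists_kinkIso_apply_eq {c d : ℝ≥0} (hc : p < c) (hd : p < d) :
    ∃ s hs, kinkIso p s hs c = d := by
  have hc' : c - p ≠ 0 := (tsub_pos_of_lt hc).ne'
  refine ⟨(d - p) / (c - p), div_ne_zero (tsub_pos_of_lt hd).ne' hc', (kink_of_ge hc.le).trans ?_⟩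
  rw [div_mul_cancel₀ _ hc', add_tsub_cancel_of_le hd.le]

theorem exists_orderIso_apply_eq {σ τ : ℕ → ℝ≥0} (hσ : StrictMono σ) (hτ : StrictMono τ)
    (hσ0 : 0 < σ 0) (hτ0 : 0 < τ 0) (m : ℕ) :
    ∃ Λ : ℝ≥0 ≃o ℝ≥0, ∀ l ≤ m, Λ (σ l) = τ l := by
  induction m with
  | zero =>
    obtain ⟨s, hs, hkink⟩ := exists_kinkIso_apply_eq hσ0 hτ0
    exact ⟨kinkIso 0 s hs, fun l hl => by rwa [Nat.le_zero.1 hl]⟩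
  | succ m ih =>
    obtain ⟨Λ, hΛ⟩ := ih
    have hlt : τ m < Λ (σ (m + 1)) := hΛ m le_rfl ▸ Λ.strictMono (hσ m.lt_succ_self)
    obtain ⟨s, hs, hkink⟩ := exists_kinkIso_apply_eq hlt (hτ m.lt_succ_self)
    refine ⟨Λ.trans (kinkIso (τ m) s hs), fun l hl => ?_⟩
    rcases Nat.le_succ_iff.1 hl with hl | rfl
    · exact (congrArg _ (hΛ l hl)).trans (kink_of_le (hτ.monotone hl))
    · exact hkink

/-- The slab `(l h, (l + 1) h]` of the time axis; the cells of the discretization are products of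
sets of functions with such slabs. -/
def timeSlab (h : ℝ≥0) (l : ℕ) : Set ℝ≥0 := Ioc (l * h) ((l + 1) * h)

theorem measurableSet_timeSlab (h : ℝ≥0) (l : ℕ) : MeasurableSet (timeSlab h l) :=
  measurableSet_Ioc

theorem isBounded_timeSlab (h : ℝ≥0) (l : ℕ) : Bornology.IsBounded (timeSlab h l) :=
  Metric.isBounded_Ioc _ _

theorem monotone_natCast_mul (h : ℝ≥0) : Monotone fun l : ℕ => (l : ℝ≥0) * h := fun _ _ hl => by
  dsimp only
  gcongr

theorem exists_mem_timeSlab {L : ℕ} (hu : 0 < u) (hL : u ≤ L * h) : ∃ l < L, u ∈ timeSlab h l := by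
  have hmem : u ∈ Ioc ((0 : ℕ) * h) (L * h) := ⟨by simpa using hu, hL⟩
  rw [← (monotone_natCast_mul h).biUnion_Ico_Ioc_map_succ 0 L] at hmem
  obtain ⟨l, hl, hul⟩ := mem_iUnion₂.1 hmem
  exact ⟨l, hl.2, by simpa [timeSlab] using hul⟩

theorem pairwise_disjoint_timeSlab (h : ℝ≥0) :
    Pairwise (Function.onFun Disjoint (timeSlab h)) := fun l m hlm => by
  simpa [timeSlab, Function.onFun] using
    (monotone_natCast_mul h).pairwise_disjoint_on_Ioc_succ hlm

theorem right_mem_timeSlab (hh : 0 < h) (l : ℕ) : (l + 1) * h ∈ timeSlab h l :=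
  ⟨by gcongr; exact lt_add_one _, le_rfl⟩

theorem lt_of_mem_timeSlab {l m : ℕ} {v : ℝ≥0} (hlm : l < m) (hu : u ∈ timeSlab h l)
    (hv : v ∈ timeSlab h m) : u < v :=
  calc u ≤ (l + 1) * h := hu.2
    _ ≤ m * h := by gcongr; exact_mod_cast hlm
    _ < v := hv.1

theorem dist_le_of_mem_timeSlab {l : ℕ} {v : ℝ≥0} (hu : u ∈ timeSlab h l) (hv : l * h ≤ v)
    (hv' : v ≤ (l + 2) * h) : dist v u ≤ 2 * h := by
  obtain ⟨hu, hu'⟩ := hu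
  rw [NNReal.dist_eq, abs_le]
  rw [← NNReal.coe_lt_coe] at hu
  rw [← NNReal.coe_le_coe] at hu' hv hv'
  push_cast at hu hu' hv hv'
  exact ⟨by linarith [h.2], by linarith⟩

theorem exists_timeChange_timeSlab (hh : 0 < h) {σ : ℕ → ℝ≥0} (hσ : ∀ l, σ l ∈ timeSlab h l)
    (L : ℕ) : ∃ Λ : ℝ≥0 ≃o ℝ≥0,
      (∀ l < L, Λ (σ l) = (l + 1) * h) ∧ ∀ u ≤ L * h, dist (Λ u) u ≤ 2 * h := by
  obtain ⟨Λ, hΛ⟩ := exists_orderIso_apply_eq (τ := fun l => (l + 1) * h)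
    (strictMono_nat_of_lt_succ fun l => lt_of_mem_timeSlab l.lt_succ_self (hσ l) (hσ (l + 1)))
    (fun l m hlm => by dsimp only; gcongr) (zero_le.trans_lt (hσ 0).1) (by positivity) L
  refine ⟨Λ, fun l hl => hΛ l hl.le, fun u hu => ?_⟩
  rcases eq_zero_or_pos u with rfl | hu0
  · rw [show Λ 0 = 0 from map_bot Λ, dist_self]
    positivity
  obtain ⟨l, hl, hul⟩ := exists_mem_timeSlab hu0 hu
  refine dist_le_of_mem_timeSlab hul ?_ ?_
  · rcases l with _ | l
    · simp
    · rw [Nat.cast_succ, ← hΛ l (by omega)]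
      exact Λ.monotone ((hσ l).2.trans (by exact_mod_cast hul.1.le))
  · have hnext := hΛ (l + 1) hl
    push_cast at hnext
    rw [show (l + 2 : ℝ≥0) = l + 1 + 1 by ring, ← hnext]
    exact Λ.monotone (lt_of_mem_timeSlab l.lt_succ_self hul (hσ (l + 1))).le

end TimeChange

/-! ### Suprema of families of continuous functions -/

section PointwiseSup

variable {T I : Type*} [TopologicalSpace T] {Y : I → CPlus T} {J : Set I}

theorem dist_le_iff_le_add {a b ε : ℝ≥0} : dist a b ≤ ε ↔ a ≤ b + ε ∧ b ≤ a + ε := by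
  rw [NNReal.dist_eq, abs_le, ← NNReal.coe_le_coe, ← NNReal.coe_le_coe]
  push_cast
  constructor <;> rintro ⟨h, h'⟩ <;> constructor <;> linarith

/-- The function `g` is the pointwise supremum of the functions `Y i` with `i ∈ J`, the supremum of
the empty family being `0`. -/
def IsPointwiseSup (Y : I → CPlus T) (J : Set I) (g : T → ℝ≥0) : Prop :=
  ∀ t, IsLUB ((fun i => Y i t) '' J) (g t)

theorem IsPointwiseSup.apply_le {g : T → ℝ≥0} (hg : IsPointwiseSup Y J g) {i : I} (hi : i ∈ J)
    (t : T) : Y i t ≤ g t :=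
  (hg t).1 (mem_image_of_mem _ hi)

theorem isPointwiseSup_finsetSup (Y : I → CPlus T) (s : Finset I) :
    IsPointwiseSup Y s fun t => s.sup fun i => Y i t := fun t => by
  simpa using Finset.isLUB_sup (s := s) (f := fun i => Y i t)

theorem isLUB_range_indicator_iff {U : I → ℝ≥0} {u r : ℝ≥0} {t : T} :
    IsLUB (range fun i => (Ici (U i)).indicator (fun _ => Y i t) u) r ↔
      IsLUB ((fun i => Y i t) '' {i | U i ≤ u}) r := by
  refine isLUB_congr (ext fun b => ?_)
  simp only [mem_upperBounds, forall_mem_range, forall_mem_image, mem_ofPred_eq]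
  refine forall_congr' fun i => ?_
  by_cases h : U i ≤ u <;> simp [h]

end PointwiseSup

section SupPath

variable {T : Type*} [MetricSpace T] [CompactSpace T] {I I' : Type*}

theorem apply_le_supNorm (x : CPlus T) (t : T) : x t ≤ supNorm x := by
  have h : dist (x t) 0 ≤ supNorm x := ContinuousMap.dist_apply_le_dist (f := x) (g := 0) t
  simpa using (dist_le_iff_le_add.1 h).1

theorem continuous_supNorm : Continuous (supNorm : CPlus T → ℝ≥0) :=
  continuous_id.nndist continuous_const

namespace IsPointwiseSup

variable {Y : I → CPlus T} {Y' : I' → CPlus T} {J : Set I} {J' : Set I'} {ε : ℝ≥0}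

theorem apply_le_apply_add {g g' : T → ℝ≥0} (hg : IsPointwiseSup Y J g)
    (hg' : IsPointwiseSup Y' J' g')
    (h : ∀ i ∈ J, supNorm (Y i) ≤ ε ∨ ∃ j ∈ J', dist (Y i) (Y' j) ≤ ε) (t : T) :
    g t ≤ g' t + ε := by
  refine (hg t).2 (forall_mem_image.2 fun i hi => ?_)
  rcases h i hi with hε | ⟨j, hj, hε⟩
  · exact ((apply_le_supNorm _ t).trans hε).trans le_add_self
  · exact (dist_le_iff_le_add.1 ((ContinuousMap.dist_apply_le_dist t).trans hε)).1.trans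
      (by gcongr; exact hg'.apply_le hj t)

theorem dist_apply_le {g g' : T → ℝ≥0} (hg : IsPointwiseSup Y J g)
    (hg' : IsPointwiseSup Y' J' g')
    (h : ∀ i ∈ J, supNorm (Y i) ≤ ε ∨ ∃ j ∈ J', dist (Y i) (Y' j) ≤ ε)
    (h' : ∀ j ∈ J', supNorm (Y' j) ≤ ε ∨ ∃ i ∈ J, dist (Y i) (Y' j) ≤ ε) (t : T) :
    dist (g t) (g' t) ≤ ε := by
  simp_rw [dist_comm (Y _)] at h'
  exact dist_le_iff_le_add.2 ⟨hg.apply_le_apply_add hg' h t, hg'.apply_le_apply_add hg h' t⟩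

theorem dist_apply_le_of_subset {J₁ J₂ : Set I} {g₁ g₂ : T → ℝ≥0} (h₁ : IsPointwiseSup Y J₁ g₁)
    (h₂ : IsPointwiseSup Y J₂ g₂) (hJ : J₁ ⊆ J₂) (h : ∀ i ∈ J₂, i ∈ J₁ ∨ supNorm (Y i) ≤ ε)
    (t : T) : dist (g₁ t) (g₂ t) ≤ ε :=
  h₁.dist_apply_le h₂ (fun i hi => .inr ⟨i, hJ hi, by simp⟩)
    (fun i hi => (h i hi).symm.imp_right fun hi => ⟨i, hi, by simp⟩) t

end IsPointwiseSup

variable {Y : I → CPlus T} {U : I → ℝ≥0} {J : Set I}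

theorem isPointwiseSup_sSup (hJ : {i ∈ J | 1 ≤ supNorm (Y i)}.Finite) :
    IsPointwiseSup Y J fun t => sSup ((fun i => Y i t) '' J) := fun t => by
  obtain ⟨b, hb⟩ := (hJ.image fun i => Y i t).bddAbove
  refine isLUB_csSup' ⟨max b 1, forall_mem_image.2 fun i hi => ?_⟩
  by_cases h : 1 ≤ supNorm (Y i)
  · exact (hb (mem_image_of_mem _ ⟨hi, h⟩)).trans (le_max_left _ _)
  · exact ((apply_le_supNorm _ t).trans (not_le.1 h).le).trans (le_max_right _ _)

theorem exists_isPointwiseSup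
    (hJ : ∀ ε : ℝ≥0, 0 < ε → {i ∈ J | ε ≤ supNorm (Y i)}.Finite) :
    ∃ g : CPlus T, IsPointwiseSup Y J g := by
  have hsup := isPointwiseSup_sSup (hJ 1 one_pos)
  refine ⟨⟨fun t => sSup ((fun i => Y i t) '' J), ?_⟩, hsup⟩
  refine continuous_of_uniform_approx_of_continuous fun V hV => ?_
  obtain ⟨ε, hε, hV⟩ := Metric.uniformity_basis_dist_le.mem_iff.1 hV
  lift ε to ℝ≥0 using hε.le
  refine ⟨fun t => (hJ ε hε).toFinset.sup fun i => Y i t,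
    Continuous.finset_sup_apply fun i _ => (Y i).continuous, fun t => hV ?_⟩
  change dist _ _ ≤ _
  rw [dist_comm]
  refine (isPointwiseSup_finsetSup Y (hJ ε hε).toFinset).dist_apply_le_of_subset hsup
    (fun i hi => ((hJ ε hε).mem_toFinset.1 hi).1) (fun i hi => ?_) t
  by_cases h : ε ≤ supNorm (Y i)
  · exact .inl ((hJ ε hε).mem_toFinset.2 ⟨hi, h⟩)
  · exact .inr (not_le.1 h).le

/-- The path `x` is the running supremum `x(u) = sup {Y i : U i ≤ u}`. -/
def IsSupPath (Y : I → CPlus T) (U : I → ℝ≥0) (x : SkorokhodSpace (CPlus T)) : Prop :=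
  ∀ u, IsPointwiseSup Y {i | U i ≤ u} (x u)

/-- Only finitely many of the points `(Y i, U i)` lie in any bounded set. -/
def LocallyFinitePoints (Y : I → CPlus T) (U : I → ℝ≥0) : Prop :=
  ∀ ε : ℝ≥0, 0 < ε → ∀ K, {i | ε ≤ supNorm (Y i) ∧ U i ≤ K}.Finite

namespace LocallyFinitePoints

theorem eventually_le_iff_le (hfin : LocallyFinitePoints Y U) {ε : ℝ≥0} (hε : 0 < ε) (u : ℝ≥0) :
    ∀ᶠ v in 𝓝 u, ∀ i, ε ≤ supNorm (Y i) → U i ≠ u → (U i ≤ v ↔ U i ≤ u) := by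
  have hall : ∀ᶠ v in 𝓝 u, ∀ i ∈ {i | ε ≤ supNorm (Y i) ∧ U i ≤ u + 1},
      U i ≠ u → (U i ≤ v ↔ U i ≤ u) := by
    refine (eventually_all_finite (hfin ε hε (u + 1))).2 fun i _ => ?_
    rcases lt_trichotomy (U i) u with hi | hi | hi
    · filter_upwards [lt_mem_nhds hi] with v hv _ using iff_of_true hv.le hi.le
    · exact Eventually.of_forall fun v hv => absurd hi hv
    · filter_upwards [gt_mem_nhds hi] with v hv _ using iff_of_false hv.not_ge hi.not_ge
  filter_upwards [hall, gt_mem_nhds (lt_add_one u)] with v hv hvu i hi hiu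
  by_cases hi' : U i ≤ u + 1
  · exact hv i ⟨hi, hi'⟩ hiu
  · exact iff_of_false (fun h => hi' (h.trans hvu.le)) fun h => hi' (h.trans le_self_add)

theorem exists_isSupPath (hfin : LocallyFinitePoints Y U) : ∃ x, IsSupPath Y U x := by
  have hle : ∀ u, ∃ g : CPlus T, IsPointwiseSup Y {i | U i ≤ u} g := fun u =>
    exists_isPointwiseSup fun ε hε => (hfin ε hε u).subset fun i hi => hi.symm
  have hlt : ∀ u, ∃ g : CPlus T, IsPointwiseSup Y {i | U i < u} g := fun u =>
    exists_isPointwiseSup fun ε hε => (hfin ε hε u).subset fun i hi => ⟨hi.2, hi.1.le⟩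
  choose x hx using hle
  choose y hy using hlt
  refine ⟨⟨x, fun u => ?_, fun u => ⟨y u, ?_⟩⟩, hx⟩
  · refine Metric.nhds_basis_closedBall.tendsto_right_iff.2 fun ε hε => ?_
    lift ε to ℝ≥0 using hε.le
    filter_upwards [mem_nhdsWithin_of_mem_nhds (hfin.eventually_le_iff_le hε u),
      self_mem_nhdsWithin] with v hv huv
    rw [Metric.mem_closedBall']
    refine (ContinuousMap.dist_le ε.coe_nonneg).2 ((hx u).dist_apply_le_of_subset (hx v)
      (fun i (hi : U i ≤ u) => hi.trans huv) fun i hi => ?_)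
    by_contra! ⟨hiu, hiε⟩
    exact hiu ((hv i hiε.le fun h => hiu h.le).1 hi)
  · refine Metric.nhds_basis_closedBall.tendsto_right_iff.2 fun ε hε => ?_
    lift ε to ℝ≥0 using hε.le
    filter_upwards [mem_nhdsWithin_of_mem_nhds (hfin.eventually_le_iff_le hε u),
      self_mem_nhdsWithin] with v hv hvu
    refine (ContinuousMap.dist_le ε.coe_nonneg).2 ((hx v).dist_apply_le_of_subset (hy u)
      (fun i (hi : U i ≤ v) => hi.trans_lt hvu) fun i hi => ?_)
    by_contra! ⟨hiv, hiε⟩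
    exact hiv ((hv i hiε.le hi.ne).2 hi.le)

end LocallyFinitePoints

end SupPath

/-! ### Paths of partial maxima -/

section MaximaPath

/-- The rescaled time `(i + 1) / n` at which the variable of index `i` enters the partial maxima:
the variables are indexed from `0`, so that the first `⌊n u⌋` of them have entered at time `u`. -/
noncomputable def entryTime (n i : ℕ) : ℝ≥0 := (i + 1) / n

theorem entryTime_le_iff {n : ℕ} (hn : n ≠ 0) {i : ℕ} {u : ℝ≥0} :
    entryTime n i ≤ u ↔ i < ⌊(n : ℝ≥0) * u⌋₊ := by
  rw [entryTime, div_le_iff₀ (by positivity), ← Nat.succ_le_iff, Nat.le_floor_iff zero_le,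
    mul_comm u, Nat.cast_succ]

variable {T : Type*} [MetricSpace T]

theorem isSupPath_entryTime_iff {n : ℕ} (hn : n ≠ 0) {f : ℕ → CPlus T}
    {x : SkorokhodSpace (CPlus T)} : IsSupPath f (entryTime n) x ↔
      ∀ u t, x u t = (Finset.range ⌊(n : ℝ≥0) * u⌋₊).sup fun i => f i t := by
  refine forall₂_congr fun u t => ?_
  have hsup := isPointwiseSup_finsetSup f (Finset.range ⌊(n : ℝ≥0) * u⌋₊) t
  simp_rw [entryTime_le_iff hn, ← Finset.mem_range, Finset.setOfPred_mem]
  exact ⟨fun h => h.unique hsup, fun h => h ▸ hsup⟩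

variable [CompactSpace T]

theorem locallyFinitePoints_entryTime {n : ℕ} (hn : n ≠ 0) (f : ℕ → CPlus T) :
    LocallyFinitePoints f (entryTime n) := fun _ _ K =>
  (finite_lt_nat ⌊(n : ℝ≥0) * K⌋₊).subset fun _ hi => (entryTime_le_iff hn).1 hi.2

theorem exists_maximaPath (n : ℕ) (f : ℕ → CPlus T) : ∃ x : SkorokhodSpace (CPlus T),
    ∀ u t, x u t = (Finset.range ⌊(n : ℝ≥0) * u⌋₊).sup fun i => f i t := by
  rcases eq_or_ne n 0 with rfl | hn
  · exact ⟨⟨fun _ => 0, fun _ => continuousWithinAt_const, fun _ => ⟨0, tendsto_const_nhds⟩⟩,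
      fun u t => by simp⟩
  · exact (locallyFinitePoints_entryTime hn f).exists_isSupPath.imp fun x =>
      (isSupPath_entryTime_iff hn).1

theorem continuous_maximaPath {n : ℕ} {Φ : (ℕ → CPlus T) → SkorokhodSpace (CPlus T)}
    (hΦ : ∀ f u t, Φ f u t = (Finset.range ⌊(n : ℝ≥0) * u⌋₊).sup fun i => f i t) :
    Continuous Φ := by
  have hsup : ∀ f u, IsPointwiseSup f (Finset.range ⌊(n : ℝ≥0) * u⌋₊) (Φ f u) := fun f u => by
    simpa only [← hΦ] using isPointwiseSup_finsetSup f (Finset.range ⌊(n : ℝ≥0) * u⌋₊)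
  refine continuous_def.2 fun s hs => isOpen_iff_mem_nhds.2 fun f hf => ?_
  obtain ⟨K, ε, hε, h⟩ := hs (Φ f) hf
  lift ε to ℝ≥0 using hε.le
  have hnhd : ∀ᶠ g in 𝓝 f, ∀ i ∈ Finset.range ⌊(n : ℝ≥0) * K⌋₊, dist (g i) (f i) < ε :=
    (eventually_all_finset _).2 fun i _ =>
      (continuous_apply i).continuousAt.eventually (Metric.ball_mem_nhds (f i) hε)
  filter_upwards [hnhd] with g hg
  refine h ⟨OrderIso.refl _, fun u hu => ⟨by simp, (ContinuousMap.dist_le ε.coe_nonneg).2 ?_⟩⟩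
  have hgf : ∀ i ∈ Finset.range ⌊(n : ℝ≥0) * u⌋₊, dist (g i) (f i) ≤ ε := fun i hi =>
    (hg i (Finset.range_subset_range.2 (Nat.floor_le_floor (by gcongr)) hi)).le
  exact (hsup g u).dist_apply_le (hsup f u) (fun i hi => .inr ⟨i, hi, hgf i hi⟩)
    fun i hi => .inr ⟨i, hi, hgf i hi⟩

end MaximaPath

/-! ### Sharp-weak convergence -/

section SharpWeak

theorem tendsto_finiteMeasure_of_null_frontier {E ι : Type*} [MeasurableSpace E]
    [TopologicalSpace E] [HasOuterApproxClosed E] [OpensMeasurableSpace E] {l : Filter ι}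
    {μ : ι → FiniteMeasure E} {ν : FiniteMeasure E} (h : Tendsto μ l (𝓝 ν)) {A : Set E}
    (hA : (ν : Measure E) (frontier A) = 0) : Tendsto (fun i => μ i A) l (𝓝 (ν A)) := by
  have hmass : Tendsto (fun i => (μ i).mass) l (𝓝 ν.mass) :=
    (FiniteMeasure.continuous_mass.tendsto ν).comp h
  rcases eq_or_ne ν 0 with rfl | hν
  · simp only [FiniteMeasure.zero_mass, FiniteMeasure.coeFn_zero] at hmass ⊢
    exact tendsto_of_tendsto_of_tendsto_of_le_of_le tendsto_const_nhds hmass (fun _ => zero_le)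
      fun i => (μ i).apply_le_mass A
  · have hE : Nonempty E := by
      by_contra hE
      have := not_nonempty_iff.1 hE
      exact hν (Subtype.ext (Measure.eq_zero_of_isEmpty _))
    have hA' : (ν.normalize : Measure E) (frontier A) = 0 := by
      rw [ν.toMeasure_normalize_eq_of_nonzero hν, Measure.smul_apply, hA, smul_zero]
    simp_rw [FiniteMeasure.self_eq_mass_mul_normalize]
    exact hmass.mul (ProbabilityMeasure.tendsto_measure_of_null_frontier_of_tendsto
      (FiniteMeasure.tendsto_normalize_of_tendsto h hν)
      ((ν.normalize.null_iff_toMeasure_null _).2 hA'))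

theorem withDensity_coe_apply_of_eqOn_one {E : Type*} [MeasurableSpace E] {μ : Measure E}
    {φ : E → ℝ≥0} {A : Set E} (hA : MeasurableSet A) (hφ : EqOn φ 1 A) :
    μ.withDensity (fun x => φ x) A = μ A := by
  rw [withDensity_apply _ hA,
    setLIntegral_congr_fun (g := fun _ => 1) hA fun x hx => by simp [hφ hx], lintegral_one,
    Measure.restrict_apply_univ]

variable {E : Type*} [PseudoMetricSpace E] [MeasurableSpace E] [BorelSpace E]

theorem BoundedlyFinite.isFiniteMeasure_withDensity {μ : Measure E} (hμ : BoundedlyFinite μ)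
    {φ : E →ᵇ ℝ≥0} (hφ : Bornology.IsBounded (Function.support φ)) :
    IsFiniteMeasure (μ.withDensity fun x => φ x) := by
  refine MeasureTheory.isFiniteMeasure_withDensity (ne_of_lt ?_)
  have hsupp : (Function.support fun x => (φ x : ℝ≥0∞)) ⊆ Function.support φ := fun x hx =>
    ENNReal.coe_ne_zero.1 hx
  rw [← setLIntegral_eq_of_support_subset hsupp]
  exact setLIntegral_lt_top_of_bddAbove (hμ _ φ.continuous.isOpen_support.measurableSet hφ).ne
    (φ.isBounded_range.bddAbove.mono (image_subset_range _ _))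

theorem SharpWeakTendsto.tendsto_integral_withDensity {μ : ℕ → Measure E} {ν : Measure E}
    (h : SharpWeakTendsto μ ν)
    {φ : E →ᵇ ℝ≥0} (hφ : Bornology.IsBounded (Function.support φ)) (f : E →ᵇ ℝ) :
    Tendsto (fun n => ∫ x, f x ∂(μ n).withDensity fun x => φ x) atTop
      (𝓝 (∫ x, f x ∂ν.withDensity fun x => φ x)) := by
  simp_rw [integral_withDensity_eq_integral_smul φ.continuous.measurable, NNReal.smul_def,
    smul_eq_mul]
  refine h.tendsto (φ.comp _ isometry_subtype_coe.lipschitz * f) (hφ.subset fun x hx => ?_)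
  have hx' : (φ x : ℝ) * f x ≠ 0 := hx
  exact NNReal.coe_ne_zero.1 (left_ne_zero_of_mul hx')

theorem SharpWeakTendsto.tendsto_measureReal {μ : ℕ → Measure E} {ν : Measure E}
    (h : SharpWeakTendsto μ ν) {A : Set E} (hA : MeasurableSet A) (hb : Bornology.IsBounded A)
    (hfr : ν (frontier A) = 0) : Tendsto (fun n => (μ n).real A) atTop (𝓝 (ν.real A)) := by
  let φ : E →ᵇ ℝ≥0 := thickenedIndicator one_pos A
  have hφ : Bornology.IsBounded (Function.support φ) :=
    (hb.thickening (δ := 1)).subset fun x hx => by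
      contrapose! hx
      exact Function.notMem_support.2 (thickenedIndicator_zero one_pos A hx)
  have hφA : EqOn φ 1 A := fun x hx => thickenedIndicator_one one_pos A hx
  let μφ (n : ℕ) : FiniteMeasure E := ⟨_, (h.boundedlyFinite n).isFiniteMeasure_withDensity hφ⟩
  let νφ : FiniteMeasure E := ⟨_, h.boundedlyFinite_limit.isFiniteMeasure_withDensity hφ⟩
  have hlim : Tendsto μφ atTop (𝓝 νφ) :=
    FiniteMeasure.tendsto_iff_forall_integral_tendsto.2 (h.tendsto_integral_withDensity hφ)
  have hfr' : (νφ : Measure E) (frontier A) = 0 := withDensity_absolutelyContinuous _ _ hfr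
  have := (NNReal.continuous_coe.tendsto _).comp (tendsto_finiteMeasure_of_null_frontier hlim hfr')
  have hreal : ∀ μ : Measure E, μ.real A = (μ.withDensity fun x => φ x).real A := fun μ => by
    rw [measureReal_def, measureReal_def, withDensity_coe_apply_of_eqOn_one hA hφA]
  simp_rw [fun n => hreal (μ n), hreal ν]
  exact this

end SharpWeak

/-! ### Polar coordinates -/

section Polar

variable {T : Type*} [MetricSpace T] [CompactSpace T]

namespace ExtCone

theorem dist_eq (p q : ExtCone T) : dist p q =
    |(p.radius⁻¹).toReal - (q.radius⁻¹).toReal| + dist p.shape q.shape := rfl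

theorem continuous_shape : Continuous (shape : ExtCone T → CPlus T) :=
  (LipschitzWith.of_dist_le_mul (K := 1) fun p q => by
    rw [dist_eq, NNReal.coe_one, one_mul]
    exact le_add_of_nonneg_left (abs_nonneg _)).continuous

theorem continuous_toReal_inv_radius : Continuous fun p : ExtCone T => (p.radius⁻¹).toReal :=
  (LipschitzWith.of_dist_le_mul (K := 1) fun p q => by
    rw [dist_eq, NNReal.coe_one, one_mul, Real.dist_eq]
    exact le_add_of_nonneg_right dist_nonneg).continuous

theorem continuous_radius : Continuous (radius : ExtCone T → ℝ≥0∞) := by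
  have hradius : (radius : ExtCone T → ℝ≥0∞) =
      fun p => (ENNReal.ofReal (p.radius⁻¹).toReal)⁻¹ := by
    funext p
    rw [ENNReal.ofReal_toReal (ENNReal.inv_ne_top.2 p.radius_ne_zero), inv_inv]
  rw [hradius]
  exact (ENNReal.continuous_ofReal.comp continuous_toReal_inv_radius).inv

theorem continuous_polar : Continuous (polar : CPlusZero T → ExtCone T) := by
  have hinv : Continuous fun x : CPlusZero T => (supNorm x.1)⁻¹ :=
    (continuous_supNorm.comp continuous_subtype_val).inv₀ fun x => supNorm_ne_zero x.2
  have hshape : Continuous fun x : CPlusZero T => (polar x).shape :=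
    hinv.smul continuous_subtype_val
  have hradius (x : CPlusZero T) : ((polar x).radius⁻¹).toReal = ((supNorm x.1)⁻¹ : ℝ≥0) := by
    simp [polar]
  rw [continuous_iff_continuousAt]
  intro x
  rw [ContinuousAt, tendsto_iff_dist_tendsto_zero]
  simp_rw [dist_eq, hradius]
  simpa only [Real.dist_eq, add_zero, Function.comp_apply] using
    (tendsto_iff_dist_tendsto_zero.1 ((NNReal.continuous_coe.comp hinv).tendsto x)).add
      (tendsto_iff_dist_tendsto_zero.1 (hshape.tendsto x))

/-- The inverse `(r, s) ↦ r s` of the polar decomposition. Points of infinite radius have no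
counterpart in `C⁺(T)` and are sent to `0`. -/
noncomputable def unpolar (p : ExtCone T) : CPlus T := p.radius.toNNReal • p.shape

theorem unpolar_polar (x : CPlusZero T) : unpolar (polar x) = x.1 := by
  change (supNorm x.1 : ℝ≥0∞).toNNReal • (supNorm x.1)⁻¹ • x.1 = x.1
  rw [ENNReal.toNNReal_coe, smul_inv_smul₀ (supNorm_ne_zero x.2)]

theorem supNorm_unpolar (p : ExtCone T) : supNorm (unpolar p) = p.radius.toNNReal := by
  rw [unpolar, supNorm_smul, p.supNorm_shape, mul_one]

theorem continuousAt_unpolar {p : ExtCone T} (hp : p.radius ≠ ∞) : ContinuousAt unpolar p :=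
  ((ENNReal.tendsto_toNNReal hp).comp continuous_radius.continuousAt).smul
    continuous_shape.continuousAt

theorem measurable_unpolar : Measurable (unpolar : ExtCone T → CPlus T) :=
  continuous_radius.measurable.ennreal_toNNReal.smul continuous_shape.measurable

theorem isBounded_le_radius {ε : ℝ≥0} (hε : 0 < ε) :
    Bornology.IsBounded {p : ExtCone T | (ε : ℝ≥0∞) ≤ p.radius} := by
  rw [Metric.isBounded_iff]
  refine ⟨(ε : ℝ)⁻¹ + 2, fun p hp q hq => ?_⟩
  have hinv {p : ExtCone T} (hp : (ε : ℝ≥0∞) ≤ p.radius) :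
      (p.radius⁻¹).toReal ∈ Icc 0 (ε : ℝ)⁻¹ := by
    refine ⟨ENNReal.toReal_nonneg, ?_⟩
    have : p.radius⁻¹ ≤ ((ε⁻¹ : ℝ≥0) : ℝ≥0∞) := by
      rw [ENNReal.coe_inv hε.ne']
      exact ENNReal.inv_le_inv.2 hp
    simpa using ENNReal.toReal_mono ENNReal.coe_ne_top this
  have hradius : |(p.radius⁻¹).toReal - (q.radius⁻¹).toReal| ≤ (ε : ℝ)⁻¹ := by
    simpa using abs_sub_le_of_le_of_le (hinv hp).1 (hinv hp).2 (hinv hq).1 (hinv hq).2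
  have hshape (p : ExtCone T) : dist p.shape 0 = 1 := by
    rw [← coe_nndist, ← NNReal.coe_one, ← p.supNorm_shape, supNorm]
  have htri := dist_triangle_right p.shape q.shape 0
  rw [hshape, hshape] at htri
  rw [dist_eq]
  linarith

theorem isBounded_unpolar_preimage {ε : ℝ≥0} (hε : 0 < ε) {A : Set (CPlus T)}
    (hA : ∀ x ∈ A, ε ≤ supNorm x) : Bornology.IsBounded (unpolar ⁻¹' A) := by
  refine (isBounded_le_radius (T := T) hε).subset fun p hp => ?_
  have hp' := hA _ hp
  rw [supNorm_unpolar] at hp'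
  exact (ENNReal.coe_le_coe.2 hp').trans ENNReal.coe_toNNReal_le_self

theorem frontier_unpolar_preimage_subset (A : Set (CPlus T)) :
    frontier (unpolar ⁻¹' A) ⊆ unpolar ⁻¹' frontier A ∪ {p | p.radius = ∞} := by
  intro p hp
  by_cases h : p.radius = ∞
  · exact Or.inr h
  · left
    have hclosure (B : Set (CPlus T)) (hB : p ∈ closure (unpolar ⁻¹' B)) : unpolar p ∈ closure B :=
      closure_mono (image_preimage_subset _ _)
        ((continuousAt_unpolar h).continuousWithinAt.mem_closure_image hB)
    rw [frontier_eq_closure_inter_closure] at hp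
    rw [mem_preimage, frontier_eq_closure_inter_closure]
    exact ⟨hclosure _ hp.1, hclosure _ hp.2⟩

theorem inducedMeasure_unpolar_preimage (μ : Measure (CPlus T)) {A : Set (CPlus T)}
    (hA : MeasurableSet A) (h0 : 0 ∉ A) : inducedMeasure μ (unpolar ⁻¹' A) = μ A := by
  have hne : MeasurableSet {x : CPlus T | x ≠ 0} := isOpen_ne.measurableSet
  have hpre : (polar ⁻¹' (unpolar ⁻¹' A) : Set (CPlusZero T)) = Subtype.val ⁻¹' A := by
    ext x
    simp [unpolar_polar]
  rw [inducedMeasure, Measure.map_apply continuous_polar.measurable (measurable_unpolar hA), hpre]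
  refine ((MeasurableEmbedding.subtype_coe hne).comap_preimage μ A).trans ?_
  rw [Subtype.range_coe]
  congr 1
  exact inter_eq_left.2 fun x hx => ne_of_mem_of_not_mem hx h0

theorem tendsto_mul_measureReal {μ : ℕ → Measure (CPlus T)} {ν : Measure (ExtCone T)}
    (h : SharpWeakTendsto (fun n => (n : ℝ≥0∞) • inducedMeasure (μ n)) ν)
    (hν : ν {p | p.radius = ∞} = 0) {A : Set (CPlus T)} (hA : MeasurableSet A) {ε : ℝ≥0}
    (hε : 0 < ε) (hAε : ∀ x ∈ A, ε ≤ supNorm x) (hfr : ν.map unpolar (frontier A) = 0) :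
    Tendsto (fun n : ℕ => n * (μ n).real A) atTop (𝓝 ((ν.map unpolar).real A)) := by
  rw [Measure.map_apply measurable_unpolar isClosed_frontier.measurableSet] at hfr
  have h0 : (0 : CPlus T) ∉ A := fun h0 => by
    have := hAε _ h0
    simp [supNorm, hε.ne'] at this
  rw [map_measureReal_apply measurable_unpolar hA]
  refine (h.tendsto_measureReal (measurable_unpolar hA) (isBounded_unpolar_preimage hε hAε)
    (measure_mono_null (frontier_unpolar_preimage_subset A)
      (measure_union_null hfr hν))).congr fun n => ?_
  rw [measureReal_def, Measure.smul_apply, inducedMeasure_unpolar_preimage _ hA h0, smul_eq_mul,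
    ENNReal.toReal_mul, ENNReal.toReal_natCast, measureReal_def]

end ExtCone

end Polar

/-! ### Partitions into continuity sets -/

section Partition

variable {E : Type*} [PseudoMetricSpace E] [MeasurableSpace E] {ν : Measure E} {C : Set E}

theorem exists_level_null_frontier [OpensMeasurableSpace E] {f : E → ℝ} (hf : Continuous f)
    {a b : ℝ} (hab : a < b) (hfin : ν {w | a ≤ f w} ≠ ∞) :
    ∃ r ∈ Ioo a b, ν (frontier {w | r ≤ f w}) = 0 := by
  have : IsFiniteMeasure (ν.restrict {w | a ≤ f w}) := ⟨by simpa using hfin.lt_top⟩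
  have hcount := Measure.countable_meas_level_set_pos (μ := ν.restrict {w | a ≤ f w}) hf.measurable
  obtain ⟨r, hr, har, hrb⟩ := (hcount.dense_compl ℝ).exists_between hab
  have hlevel : (ν.restrict {w | a ≤ f w}) {w | f w = r} = 0 := nonpos_iff_eq_zero.1 (not_lt.1 hr)
  rw [Measure.restrict_apply (measurableSet_eq_fun hf.measurable measurable_const)] at hlevel
  refine ⟨r, ⟨har, hrb⟩, measure_mono_null (fun w hw => ?_) hlevel⟩
  have hrw : r = f w := frontier_le_subset_eq continuous_const hf hw
  exact ⟨hrw.symm, har.le.trans hrw.le⟩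

/-- A partition of `C` into continuity sets of `ν`: the cell indexed by `some j` lies within
distance `δ` of the point `center j`, while the cell indexed by `none` is a remainder on whose
shape nothing is required. -/
structure ContinuityPartition (ν : Measure E) (C : Set E) (δ : ℝ) (κ : Type*) where
  cell : Option κ → Set E
  center : κ → E
  measurableSet_cell : ∀ j, MeasurableSet (cell j)
  measure_frontier_cell : ∀ j, ν (frontier (cell j)) = 0
  disjoint_cell : Pairwise fun j j' => Disjoint (cell j) (cell j')
  iUnion_cell : ⋃ j, cell j = C
  dist_center_le : ∀ j, ∀ w ∈ cell (some j), dist w (center j) ≤ δ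

theorem ContinuityPartition.cell_subset {δ : ℝ} {κ : Type*} (p : ContinuityPartition ν C δ κ)
    (j : Option κ) : p.cell j ⊆ C :=
  (subset_iUnion p.cell j).trans_eq p.iUnion_cell

theorem null_frontier_biUnion {κ : Type*} {A : κ → Set E} (hA : ∀ j, ν (frontier (A j)) = 0)
    {s : Set κ} (hs : s.Finite) : ν (frontier (⋃ j ∈ s, A j)) = 0 := by
  induction s, hs using Set.Finite.induction_on with
  | empty => simp
  | insert _ _ ih =>
    rw [biUnion_insert]
    refine measure_mono_null (frontier_union_subset _ _) (measure_union_null ?_ ?_)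
    · exact measure_mono_null inter_subset_left (hA _)
    · exact measure_mono_null inter_subset_right ih

theorem null_frontier_disjointed {κ : Type*} [Preorder κ] [LocallyFiniteOrderBot κ] {A : κ → Set E}
    (hA : ∀ j, ν (frontier (A j)) = 0) (j : κ) : ν (frontier (disjointed A j)) = 0 :=
  disjointedRec (p := fun B => ν (frontier B) = 0)
    (fun {B i} hB => by
      rw [sdiff_eq]
      exact null_frontier_inter hB (by rw [frontier_compl]; exact hA i)) (hA j)

variable [BorelSpace E]

theorem null_frontier_inter_of_restrict (hC : ν (frontier C) = 0) {B : Set E}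
    (hB : (ν.restrict C) (frontier B) = 0) : ν (frontier (C ∩ B)) = 0 := by
  rw [Measure.restrict_apply isClosed_frontier.measurableSet] at hB
  refine measure_mono_null (fun w hw => ?_) (measure_union_null hC hB)
  by_cases hwC : w ∈ frontier C
  · exact Or.inl hwC
  · rcases frontier_inter_subset C B hw with h | h
    · exact absurd h.1 hwC
    · exact Or.inr ⟨h.2, by_contra fun hn => hwC ⟨h.1, fun hi => hn (interior_subset hi)⟩⟩

variable [SecondCountableTopology E] [Nonempty E]

theorem exists_null_frontier_balls (μ : Measure E) [IsFiniteMeasure μ] {δ : ℝ} (hδ : 0 < δ)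
    {η : ℝ≥0∞} (hη : 0 < η) : ∃ (k : ℕ) (q : Fin k → E) (r : Fin k → ℝ), (∀ j, r j ≤ δ) ∧
      (∀ j, μ (frontier (Metric.ball (q j) (r j))) = 0) ∧
      μ (⋃ j, Metric.ball (q j) (r j))ᶜ ≤ η := by
  let q := TopologicalSpace.denseSeq E
  choose r hr hrfr using fun m => exists_null_frontier_thickening μ {q m} (half_lt_self hδ)
  simp only [Metric.thickening_singleton] at hrfr
  have hcover : ⋃ m, Metric.ball (q m) (r m) = univ := by
    refine eq_univ_of_forall fun w => ?_
    obtain ⟨m, hm⟩ := (TopologicalSpace.denseRange_denseSeq E).exists_dist_lt w (half_pos hδ)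
    exact mem_iUnion.2 ⟨m, hm.trans (hr m).1⟩
  have hlim : Tendsto (fun k : ℕ => μ (⋃ m < k, Metric.ball (q m) (r m))ᶜ) atTop (𝓝 0) := by
    have hanti : Antitone fun k : ℕ => (⋃ m < k, Metric.ball (q m) (r m))ᶜ := fun k k' hk =>
      compl_subset_compl.2 (biUnion_subset_biUnion_left fun m hm => lt_of_lt_of_le hm hk)
    have hempty : ⋂ k : ℕ, (⋃ m < k, Metric.ball (q m) (r m))ᶜ = ∅ := by
      rw [← compl_iUnion, compl_empty_iff, ← univ_subset_iff, ← hcover]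
      exact iUnion_subset fun m w hw =>
        mem_iUnion.2 ⟨m + 1, mem_biUnion (mem_ofPred.2 (Nat.lt_succ_self m)) hw⟩
    rw [← measure_empty (μ := μ), ← hempty]
    exact tendsto_measure_iInter_atTop (fun k => (MeasurableSet.biUnion (to_countable _)
      fun m _ => measurableSet_ball).compl.nullMeasurableSet) hanti ⟨0, measure_ne_top _ _⟩
  obtain ⟨k, hk⟩ := (hlim.eventually_le_const hη).exists
  have hFin : ⋃ j : Fin k, Metric.ball (q j) (r j) = ⋃ m < k, Metric.ball (q m) (r m) := by
    ext w
    simp only [mem_iUnion, exists_prop, Fin.exists_iff]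
  exact ⟨k, fun j => q j, fun j => r j, fun j => (hr j).2.le, fun j => hrfr j, by rwa [hFin]⟩

theorem exists_continuityPartition (hCm : MeasurableSet C) (hfin : ν C ≠ ∞)
    (hC : ν (frontier C) = 0) {δ : ℝ} (hδ : 0 < δ) {η : ℝ≥0∞} (hη : 0 < η) :
    ∃ (k : ℕ) (p : ContinuityPartition ν C δ (Fin k)), ν (p.cell none) ≤ η := by
  have : IsFiniteMeasure (ν.restrict C) := ⟨by simpa using hfin.lt_top⟩
  obtain ⟨k, q, r, hr, hfr, hle⟩ := exists_null_frontier_balls (ν.restrict C) hδ hη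
  let b (j : Fin k) : Set E := Metric.ball (q j) (r j)
  have hbm (j : Fin k) : MeasurableSet (b j) := measurableSet_ball
  have hfr_compl : (ν.restrict C) (frontier (⋃ j, b j)ᶜ) = 0 := by
    rw [frontier_compl, ← biUnion_univ]
    exact null_frontier_biUnion hfr finite_univ
  refine ⟨k, {
    cell := fun j => C ∩ j.elim (⋃ j, b j)ᶜ (disjointed b)
    center := q
    measurableSet_cell := ?_
    measure_frontier_cell := ?_
    disjoint_cell := ?_
    iUnion_cell := ?_
    dist_center_le := fun j w hw => (disjointed_subset b j hw.2).le.trans (hr j) }, ?_⟩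
  · rintro (_ | j)
    · exact hCm.inter (MeasurableSet.iUnion hbm).compl
    · exact hCm.inter (disjointedRec (fun {_ i} h => h.diff (hbm i)) (hbm j))
  · rintro (_ | j)
    · exact null_frontier_inter_of_restrict hC hfr_compl
    · exact null_frontier_inter_of_restrict hC (null_frontier_disjointed hfr j)
  · have hdisj (j : Fin k) : Disjoint (⋃ j, b j)ᶜ (disjointed b j) :=
      disjoint_compl_left.mono_right ((disjointed_subset b j).trans (subset_iUnion b j))
    rintro (_ | j) (_ | j') hne
    · exact absurd rfl hne
    · exact (hdisj j').mono inter_subset_right inter_subset_right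
    · exact (hdisj j).symm.mono inter_subset_right inter_subset_right
    · exact (disjoint_disjointed b (Option.some_injective _ |>.ne_iff.1 hne)).mono
        inter_subset_right inter_subset_right
  · rw [← inter_iUnion, iUnion_option]
    change C ∩ ((⋃ j, b j)ᶜ ∪ ⋃ j, disjointed b j) = C
    rw [iUnion_disjointed, compl_union_self, inter_univ]
  · change ν (C ∩ (⋃ j, b j)ᶜ) ≤ η
    rwa [inter_comm, ← Measure.restrict_apply (MeasurableSet.iUnion hbm).compl]

end Partition

/-! ### Occupied cells -/

section OccupiedCells

variable {E J I : Type*} {A : J → Set E} {h : ℝ≥0} {L : ℕ} {Y : I → E} {U : I → ℝ≥0}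

/-- The set of the cells `A j × timeSlab h l`, `l < L`, which contain at least one of the points
`(Y i, U i)`. -/
def occupiedCells (A : J → Set E) (h : ℝ≥0) (L : ℕ) (Y : I → E) (U : I → ℝ≥0) :
    Set (J × Fin L) :=
  {s | ∃ i, Y i ∈ A s.1 ∧ U i ∈ timeSlab h s.2}

/-- The union of the sets `A j` for which the cell `(j, l)` does not belong to `S`. The occupied
cells all belong to `S` when these sets are void, so that their masses are the parameters of the
law of the set of occupied cells. -/
def excludedUnion (A : J → Set E) (S : Set (J × Fin L)) (l : Fin L) : Set E :=
  ⋃ j ∈ {j | (j, l) ∉ S}, A j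

theorem occupiedCells_subset_iff {S : Set (J × Fin L)} : occupiedCells A h L Y U ⊆ S ↔
    ∀ l : Fin L, ∀ i, U i ∈ timeSlab h l → Y i ∉ excludedUnion A S l := by
  simp only [excludedUnion, mem_iUnion, mem_ofPred_eq, not_exists]
  exact ⟨fun hS l i hi j hj hA => hj (hS ⟨i, hA, hi⟩),
    fun hS ⟨j, l⟩ ⟨i, hA, hi⟩ => by_contra fun hj => hS l i hi j hj hA⟩

theorem occupiedCells_preimage {E' : Type*} (f : E' → E) (A : J → Set E) (Y : I → E') :
    occupiedCells (fun j => f ⁻¹' A j) h L Y U = occupiedCells A h L (fun i => f (Y i)) U := rfl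

theorem excludedUnion_preimage {E' : Type*} (f : E' → E) (A : J → Set E) (S : Set (J × Fin L))
    (l : Fin L) : excludedUnion (fun j => f ⁻¹' A j) S l = f ⁻¹' excludedUnion A S l := by
  simp only [excludedUnion, preimage_iUnion]

theorem excludedUnion_subset {C : Set E} (hA : ∀ j, A j ⊆ C) (S : Set (J × Fin L)) (l : Fin L) :
    excludedUnion A S l ⊆ C :=
  iUnion₂_subset fun j _ => hA j

theorem measurableSet_excludedUnion [MeasurableSpace E] [Countable J]
    (hA : ∀ j, MeasurableSet (A j)) (S : Set (J × Fin L)) (l : Fin L) :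
    MeasurableSet (excludedUnion A S l) :=
  .biUnion (to_countable _) fun j _ => hA j

/-- A set of cells is simple if it has at most one cell in each time slab, and none from the
remainder `none` of the partition. -/
def IsSimpleOccupancy {κ : Type*} (S : Set (Option κ × Fin L)) : Prop :=
  ∀ s ∈ S, s.1 ≠ none ∧ ∀ s' ∈ S, s'.2 = s.2 → s' = s

theorem exists_mem_or_nontrivial_of_not_isSimpleOccupancy {κ : Type*} {A : Option κ → Set E}
    (hA : Pairwise (Function.onFun Disjoint A)) {C : Set E} (hAC : ∀ j, A j ⊆ C)
    (hS : ¬ IsSimpleOccupancy (occupiedCells A h L Y U)) :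
    ∃ l : Fin L, (∃ i, (Y i, U i) ∈ A none ×ˢ timeSlab h l) ∨
      {i | (Y i, U i) ∈ C ×ˢ timeSlab h l}.Nontrivial := by
  contrapose! hS
  rintro ⟨j, l⟩ ⟨i, hij, hil⟩
  refine ⟨?_, ?_⟩
  · rintro rfl
    exact (hS l).1 i ⟨hij, hil⟩
  · rintro ⟨j', l'⟩ ⟨i', hij', hil'⟩ (rfl : l' = l)
    obtain rfl : i' = i := (hS l').2 ⟨hAC _ hij', hil'⟩ ⟨hAC _ hij, hil⟩
    obtain rfl : j' = j := by_contra fun hne => disjoint_left.1 (hA hne) hij' hij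
    rfl

end OccupiedCells

section Prototypes

variable {T : Type*} [MetricSpace T] [CompactSpace T] {I κ : Type*} {Y : I → CPlus T}
  {U : I → ℝ≥0} {h ε δ : ℝ≥0} {L : ℕ} {S : Set (Option κ × Fin L)} {y : κ → CPlus T}

theorem exists_first_time (hfin : LocallyFinitePoints Y U) (hh : 0 < h) (hε : 0 < ε) (l : ℕ) :
    ∃ σ ∈ timeSlab h l, ∀ i, ε ≤ supNorm (Y i) → U i ∈ timeSlab h l →
      σ ≤ U i ∧ ∃ k, ε ≤ supNorm (Y k) ∧ U k ∈ timeSlab h l ∧ U k = σ := by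
  by_cases hne : {i | ε ≤ supNorm (Y i) ∧ U i ∈ timeSlab h l}.Nonempty
  · obtain ⟨k, hk, hmin⟩ := exists_min_image _ U
      ((hfin ε hε ((l + 1) * h)).subset fun i hi => ⟨hi.1, hi.2.2⟩) hne
    exact ⟨U k, hk.2, fun i hi hil => ⟨hmin i ⟨hi, hil⟩, k, hk.1, hk.2, rfl⟩⟩
  · exact ⟨(l + 1) * h, right_mem_timeSlab hh l, fun i hi hil => absurd ⟨i, hi, hil⟩ hne⟩

/-- The path `z` is the prototype of the set of cells `S`: it has a point with value `y j` at the
right end of the `l`-th time slab for each cell `(some j, l)` of `S`. The cells `(none, l)`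
contribute the value `0`, which is immaterial to the supremum. -/
def IsPrototype (y : κ → CPlus T) (h : ℝ≥0) (S : Set (Option κ × Fin L))
    (z : SkorokhodSpace (CPlus T)) : Prop :=
  IsSupPath (fun s : S => s.1.1.elim 0 y) (fun s : S => (s.1.2 + 1) * h) z

theorem exists_isPrototype [Finite κ] (y : κ → CPlus T) (h : ℝ≥0) (S : Set (Option κ × Fin L)) :
    ∃ z, IsPrototype y h S z :=
  LocallyFinitePoints.exists_isSupPath fun _ _ _ => toFinite _

/-- If the occupied cells are simple, moving the first large point of each time slab to the right
end of the slab turns the path into one that is uniformly close to the prototype. -/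
theorem IsPrototype.mem_basicNhd {ν : Measure (CPlus T)}
    {p : ContinuityPartition ν {w | ε ≤ supNorm w} δ κ} {x z : SkorokhodSpace (CPlus T)}
    (hz : IsPrototype p.center h (occupiedCells p.cell h L Y U) z) (hx : IsSupPath Y U x)
    (hsimple : IsSimpleOccupancy (occupiedCells p.cell h L Y U)) (hfin : LocallyFinitePoints Y U)
    (hε : 0 < ε) (hεδ : ε ≤ δ) (hh : 0 < h) (hU : ∀ i, ε ≤ supNorm (Y i) → 0 < U i) :
    x ∈ z.basicNhd (L * h) (max δ (2 * h)) := by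
  have hcell (w : CPlus T) : ε ≤ supNorm w ↔ ∃ j, w ∈ p.cell j := by
    rw [← mem_iUnion, p.iUnion_cell, mem_ofPred_eq]
  have hcenter {j l} (hjl : (j, l) ∈ occupiedCells p.cell h L Y U) {w : CPlus T}
      (hw : w ∈ p.cell j) : dist w (j.elim 0 p.center) ≤ δ := by
    obtain ⟨j, rfl⟩ := Option.ne_none_iff_exists'.1 (hsimple _ hjl).1
    exact p.dist_center_le j w hw
  choose σ hσ hσ' using exists_first_time hfin hh hε
  obtain ⟨Λ, hΛσ, hΛ⟩ := exists_timeChange_timeSlab hh hσ L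
  refine ⟨Λ, fun u hu => ⟨(hΛ u hu).trans (le_max_right _ _), le_trans ?_ (le_max_left _ _)⟩⟩
  refine (ContinuousMap.dist_le δ.coe_nonneg).2 ((hx u).dist_apply_le (hz (Λ u)) ?_ ?_)
  · intro i (hiu : U i ≤ u)
    by_cases hi : ε ≤ supNorm (Y i)
    · obtain ⟨j, hj⟩ := (hcell _).1 hi
      obtain ⟨l, hl, hil⟩ := exists_mem_timeSlab (hU i hi) (hiu.trans hu)
      have hocc : (j, ⟨l, hl⟩) ∈ occupiedCells p.cell h L Y U := ⟨i, hj, hil⟩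
      have hentered : (l + 1) * h ≤ Λ u :=
        hΛσ l hl ▸ Λ.monotone ((hσ' l i hi hil).1.trans hiu)
      exact .inr ⟨⟨_, hocc⟩, hentered, hcenter hocc hj⟩
    · exact .inl ((not_le.1 hi).le.trans hεδ)
  · rintro ⟨⟨j, l⟩, hocc⟩ (hentered : (l + 1) * h ≤ Λ u)
    have ⟨i, hij, hil⟩ := hocc
    obtain ⟨k, hk, hkl, hkσ⟩ := (hσ' l i ((hcell _).2 ⟨j, hij⟩) hil).2
    obtain ⟨j', hj'⟩ := (hcell _).1 hk
    have hj'j : (j', l) = (j, l) := (hsimple _ hocc).2 (j', l) ⟨k, hj', hkl⟩ rfl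
    obtain rfl : j' = j := congrArg Prod.fst hj'j
    have hku : U k ≤ u := by rwa [hkσ, ← Λ.le_iff_le, hΛσ l l.2]
    exact .inr ⟨k, hku, hcenter hocc hj'⟩

end Prototypes

/-! ### Void probabilities of independent samples -/

section IndependentSamples

theorem tendsto_one_sub_pow_of_tendsto_mul {p : ℕ → ℝ} {m : ℕ → ℕ} {c h : ℝ}
    (hp : ∀ n, p n ≤ 1) (hc : Tendsto (fun n : ℕ => n * p n) atTop (𝓝 c))
    (hm : Tendsto (fun n : ℕ => (m n : ℝ) / n) atTop (𝓝 h)) :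
    Tendsto (fun n => (1 - p n) ^ m n) atTop (𝓝 (Real.exp (-(c * h)))) := by
  have hexp : Tendsto (fun n : ℕ => (1 + -p n) ^ n) atTop (𝓝 (Real.exp (-c))) :=
    Real.tendsto_one_add_pow_exp_of_tendsto (by simpa using hc.neg)
  have hrpow := hexp.rpow hm (Or.inl (Real.exp_pos _).ne')
  rw [← Real.exp_mul, neg_mul] at hrpow
  refine hrpow.congr' ?_
  filter_upwards [eventually_ne_atTop 0] with n hn
  rw [← sub_eq_add_neg, ← Real.rpow_natCast (1 - p n) n, ← Real.rpow_mul (by linarith [hp n]),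
    mul_div_cancel₀ _ (Nat.cast_ne_zero.2 hn), Real.rpow_natCast]

theorem tendsto_floor_natCast_mul_div (a : ℝ≥0) :
    Tendsto (fun n : ℕ => (⌊(n : ℝ≥0) * a⌋₊ : ℝ) / n) atTop (𝓝 a) := by
  refine ((tendsto_nat_floor_mul_div_atTop a.coe_nonneg).comp
    tendsto_natCast_atTop_atTop).congr fun n => ?_
  have hfloor : ⌊(a : ℝ) * n⌋₊ = ⌊(n : ℝ≥0) * a⌋₊ := eq_of_forall_le_iff fun k => by
    rw [Nat.le_floor_iff (by positivity), Nat.le_floor_iff zero_le, ← NNReal.coe_le_coe, mul_comm]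
    push_cast
    rfl
  rw [Function.comp_apply, hfloor]

theorem entryTime_mem_timeSlab_iff {n : ℕ} (hn : n ≠ 0) {h : ℝ≥0} {l i : ℕ} :
    entryTime n i ∈ timeSlab h l ↔
      i ∈ Finset.Ico ⌊(n : ℝ≥0) * (l * h)⌋₊ ⌊(n : ℝ≥0) * ((l + 1) * h)⌋₊ := by
  rw [timeSlab, mem_Ioc, ← not_le, entryTime_le_iff hn, entryTime_le_iff hn, not_lt,
    Finset.mem_Ico]

theorem tendsto_card_entryTime_mem_timeSlab (h : ℝ≥0) (l : ℕ) :
    Tendsto (fun n : ℕ => ((Finset.Ico ⌊(n : ℝ≥0) * (l * h)⌋₊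
      ⌊(n : ℝ≥0) * ((l + 1) * h)⌋₊).card : ℝ) / n) atTop (𝓝 h) := by
  have hlim := (tendsto_floor_natCast_mul_div ((l + 1) * h)).sub
    (tendsto_floor_natCast_mul_div (l * h))
  have hlength : (((l + 1) * h : ℝ≥0) : ℝ) - (l * h : ℝ≥0) = h := by push_cast; ring
  rw [hlength] at hlim
  refine hlim.congr fun n => ?_
  rw [Nat.card_Ico, Nat.cast_sub, sub_div]
  gcongr
  exact le_self_add

variable {E : Type*} [MeasurableSpace E]

theorem measureReal_forall_notMem_eq_prod {Ω ι κ : Type*} [MeasurableSpace Ω] [Fintype κ]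
    {P : Measure Ω} [IsProbabilityMeasure P] {X : ι → Ω → E} (hX : ∀ i, AEMeasurable (X i) P)
    (hindep : iIndepFun X P) {μ : Measure E} (hlaw : ∀ i, P.map (X i) = μ) {s : κ → Finset ι}
    (hs : Pairwise (Function.onFun Disjoint s)) {B : κ → Set E} (hB : ∀ l, MeasurableSet (B l)) :
    P.real {ω | ∀ l, ∀ i ∈ s l, X i ω ∉ B l} = ∏ l, (1 - μ.real (B l)) ^ (s l).card := by
  have hinj : Function.Injective fun q : Σ l, s l => (q.2 : ι) := by
    rintro ⟨l, i, hi⟩ ⟨l', i', hi'⟩ (rfl : i = i')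
    obtain rfl : l = l' := by_contra fun hne => Finset.disjoint_left.1 (hs hne) hi hi'
    rfl
  have hevent : {ω | ∀ l, ∀ i ∈ s l, X i ω ∉ B l} =
      ⋂ q ∈ (Finset.univ : Finset (Σ l, s l)), X q.2 ⁻¹' (B q.1)ᶜ := by
    ext ω
    simp only [Finset.mem_univ, iInter_true, mem_iInter, Sigma.forall, Subtype.forall]
    rfl
  have hfactor (i : ι) (l : κ) : P.real (X i ⁻¹' (B l)ᶜ) = 1 - μ.real (B l) := by
    have : IsProbabilityMeasure μ := hlaw i ▸ Measure.isProbabilityMeasure_map (hX i)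
    rw [← probReal_compl_eq_one_sub (hB l), ← hlaw i,
      map_measureReal_apply_of_aemeasurable (hX i) (hB l).compl]
  rw [hevent, measureReal_def, (hindep.precomp hinj).measure_inter_preimage_eq_mul _
    fun q _ => (hB q.1).compl, ENNReal.toReal_prod, Fintype.prod_sigma]
  simp only [← measureReal_def, hfactor, Finset.prod_const, Finset.card_univ, Fintype.card_coe]

theorem aemeasurable_occupiedCells {Ω ι J : Type*} [MeasurableSpace Ω] [Countable ι]
    {P : Measure Ω} {X : ι → Ω → E} (hX : ∀ i, AEMeasurable (X i) P) {A : J → Set E}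
    (hA : ∀ j, MeasurableSet (A j)) (h : ℝ≥0) (L : ℕ) (τ : ι → ℝ≥0) :
    AEMeasurable (fun ω => occupiedCells A h L (fun i => X i ω) τ) P := by
  have hocc : Measurable fun x : ι → E => occupiedCells A h L x τ := by
    refine measurable_set_iff.2 fun s => measurableSet_setOfPred.1 ?_
    have hunion : {x : ι → E | s ∈ occupiedCells A h L x τ} =
        ⋃ i ∈ {i | τ i ∈ timeSlab h s.2}, (fun x => x i) ⁻¹' A s.1 := by
      ext x
      simp [occupiedCells, and_comm]
    rw [hunion]
    exact .biUnion (to_countable _) fun i _ => measurable_pi_apply i (hA s.1)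
  exact hocc.comp_aemeasurable (aemeasurable_pi_lambda _ hX)

variable {J : Type*} {Ω : ℕ → Type*} [∀ n, MeasurableSpace (Ω n)] {P : ∀ n, Measure (Ω n)}
  [∀ n, IsProbabilityMeasure (P n)] {X : ∀ n, ℕ → Ω n → E}

theorem tendsto_measureReal_occupiedCells_subset (hX : ∀ n i, AEMeasurable (X n i) (P n))
    (hindep : ∀ n, iIndepFun (X n) (P n)) {μ : ℕ → Measure E}
    (hlaw : ∀ n i, (P n).map (X n i) = μ n) {ν : Measure E} {A : J → Set E} {h : ℝ≥0} {L : ℕ}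
    {S : Set (J × Fin L)} (hm : ∀ l, MeasurableSet (excludedUnion A S l))
    (hlim : ∀ l, Tendsto (fun n : ℕ => n * (μ n).real (excludedUnion A S l)) atTop
      (𝓝 (ν.real (excludedUnion A S l)))) :
    Tendsto (fun n => (P n).real
      {ω | occupiedCells A h L (fun i => X n i ω) (entryTime n) ⊆ S}) atTop
      (𝓝 (∏ l, Real.exp (-(ν.real (excludedUnion A S l) * h)))) := by
  have hμ (n : ℕ) : IsProbabilityMeasure (μ n) :=
    hlaw n 0 ▸ Measure.isProbabilityMeasure_map (hX n 0)
  refine (tendsto_finsetProd _ fun l _ => tendsto_one_sub_pow_of_tendsto_mul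
    (fun n => measureReal_le_one) (hlim l) (tendsto_card_entryTime_mem_timeSlab h l)).congr' ?_
  filter_upwards [eventually_ne_atTop 0] with n hn
  have hdisj : Pairwise (Function.onFun Disjoint fun l : Fin L =>
      Finset.Ico ⌊(n : ℝ≥0) * (l * h)⌋₊ ⌊(n : ℝ≥0) * ((l + 1) * h)⌋₊) := fun l l' hl => by
    refine Finset.disjoint_left.2 fun i hi hi' => ?_
    rw [← entryTime_mem_timeSlab_iff hn] at hi hi'
    exact disjoint_left.1 (pairwise_disjoint_timeSlab h (Fin.val_injective.ne hl)) hi hi'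
  rw [← measureReal_forall_notMem_eq_prod (hX n) (hindep n) (hlaw n) hdisj hm]
  simp only [occupiedCells_subset_iff, entryTime_mem_timeSlab_iff hn]

end IndependentSamples

/-! ### Poisson point processes -/

section HalfLine

theorem lebesgueHalfLine_apply (s : Set ℝ≥0) : lebesgueHalfLine s = volume ((↑) '' s : Set ℝ) :=
  NNReal.isClosedEmbedding_coe.measurableEmbedding.comap_apply _ _

theorem lebesgueHalfLine_singleton (a : ℝ≥0) : lebesgueHalfLine {a} = 0 := by
  rw [lebesgueHalfLine_apply, image_singleton, Real.volume_singleton]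

theorem lebesgueHalfLine_timeSlab (h : ℝ≥0) (l : ℕ) : lebesgueHalfLine (timeSlab h l) = h := by
  rw [lebesgueHalfLine_apply, timeSlab, NNReal.image_coe_Ioc, Real.volume_Ioc,
    ← ENNReal.ofReal_coe_nnreal]
  congr 1
  push_cast
  ring

instance : SigmaFinite lebesgueHalfLine := by
  have hemb : MeasurableEmbedding ((↑) : ℝ≥0 → ℝ) :=
    NNReal.isClosedEmbedding_coe.measurableEmbedding
  have : SigmaFinite (lebesgueHalfLine.map ((↑) : ℝ≥0 → ℝ)) := by
    rw [lebesgueHalfLine, hemb.map_comap]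
    infer_instance
  exact SigmaFinite.of_map _ hemb.measurable.aemeasurable this

theorem measureReal_prod_timeSlab {E : Type*} [MeasurableSpace E] (ν : Measure E) (B : Set E)
    (h : ℝ≥0) (l : ℕ) : (ν.prod lebesgueHalfLine).real (B ×ˢ timeSlab h l) = ν.real B * h := by
  rw [measureReal_prod_prod, measureReal_def lebesgueHalfLine, lebesgueHalfLine_timeSlab,
    ENNReal.coe_toReal]

end HalfLine

section SumDirac

theorem sum_dirac_apply {E ι : Type*} [MeasurableSpace E] (x : ι → E) {B : Set E}
    (hB : MeasurableSet B) :
    Measure.sum (fun i => Measure.dirac (x i)) B = {i | x i ∈ B}.encard := by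
  rw [Measure.sum_apply _ hB, ← ENNReal.tsum_set_one, tsum_subtype {i | x i ∈ B} (fun _ => 1)]
  exact tsum_congr fun i => Measure.dirac_apply' _ hB

theorem IsPointMeasure.apply_ne_top {E : Type*} [PseudoMetricSpace E] [MeasurableSpace E]
    {μ : Measure E} (hμ : IsPointMeasure μ) {B : Set E} (hB : MeasurableSet B)
    (hb : Bornology.IsBounded B) : μ B ≠ ∞ := by
  obtain ⟨I, x, rfl, hfin⟩ := hμ
  rw [sum_dirac_apply x hB, Ne, ENat.toENNReal_eq_top, encard_eq_top_iff, not_infinite]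
  exact hfin B hb

theorem poissonMeasure_real_Ioi_one_le (r : ℝ≥0) : (poissonMeasure r).real (Ioi 1) ≤ r ^ 2 := by
  have hcompl : (Ioi 1 : Set ℕ) = ({0} ∪ {1})ᶜ := by
    ext k
    simp only [mem_Ioi, mem_compl_iff, mem_union, mem_singleton_iff]
    omega
  rw [hcompl, probReal_compl_eq_one_sub (.of_discrete),
    measureReal_union (by simp) (.of_discrete), poissonMeasure_real_singleton,
    poissonMeasure_real_singleton]
  simp only [pow_zero, Nat.factorial, pow_one]
  push_cast
  nlinarith [Real.add_one_le_exp (-(r : ℝ)), r.coe_nonneg]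

end SumDirac

namespace IsPoissonPointProcess

section PointProcess

variable {E Ω : Type*} [PseudoMetricSpace E] [MeasurableSpace E] [MeasurableSpace Ω]
  {μ : Measure E} {P : Measure Ω} {B : Set E}

theorem measurable_count {N : Ω → Measure E} (hN : IsPoissonPointProcess N μ P)
    (hB : MeasurableSet B) : Measurable fun ω => N ω B :=
  (Measure.measurable_coe hB).comp hN.measurable

theorem measureReal_count_mem {N : Ω → Measure E} (hN : IsPoissonPointProcess N μ P)
    (hB : MeasurableSet B) (hb : Bornology.IsBounded B) {s : Set ℝ≥0∞} (hs : MeasurableSet s) :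
    P.real {ω | N ω B ∈ s} =
      (poissonMeasure (μ B).toNNReal).real ((fun k : ℕ => (k : ℝ≥0∞)) ⁻¹' s) := by
  rw [← map_measureReal_apply measurable_from_top hs, ← hN.map_apply B hB hb,
    map_measureReal_apply (hN.measurable_count hB) hs]
  rfl

variable {ι : Ω → Type*} {x : ∀ ω, ι ω → E}
  (hN : IsPoissonPointProcess (fun ω => Measure.sum fun i => Measure.dirac (x ω i)) μ P)
include hN

theorem finite_mem (hB : MeasurableSet B) (hb : Bornology.IsBounded B) (ω : Ω) :
    {i | x ω i ∈ B}.Finite := by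
  have hcount := (hN.isPointMeasure ω).apply_ne_top hB hb
  rwa [sum_dirac_apply _ hB, Ne, ENat.toENNReal_eq_top, encard_eq_top_iff, not_infinite] at hcount

theorem measurableSet_forall_notMem (hB : MeasurableSet B) :
    MeasurableSet {ω | ∀ i, x ω i ∉ B} := by
  have hcount := hN.measurable_count hB (measurableSet_singleton 0)
  simpa [preimage, sum_dirac_apply _ hB, eq_empty_iff_forall_notMem] using hcount

theorem measureReal_forall_notMem (hB : MeasurableSet B) (hb : Bornology.IsBounded B) :
    P.real {ω | ∀ i, x ω i ∉ B} = Real.exp (-μ.real B) := by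
  have hcount := hN.measureReal_count_mem hB hb (measurableSet_singleton 0)
  have hzero : (fun k : ℕ => (k : ℝ≥0∞)) ⁻¹' {0} = {0} := by ext k; simp
  rw [hzero, poissonMeasure_real_singleton, pow_zero, Nat.factorial_zero, Nat.cast_one, mul_one,
    div_one, ENNReal.coe_toNNReal_eq_toReal, ← measureReal_def] at hcount
  simpa [sum_dirac_apply _ hB, eq_empty_iff_forall_notMem] using hcount

theorem measureReal_exists_mem_le [IsProbabilityMeasure P] (hB : MeasurableSet B)
    (hb : Bornology.IsBounded B) : P.real {ω | ∃ i, x ω i ∈ B} ≤ μ.real B := by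
  have hcompl : {ω | ∃ i, x ω i ∈ B} = {ω | ∀ i, x ω i ∉ B}ᶜ := by ext; simp
  rw [hcompl, probReal_compl_eq_one_sub (hN.measurableSet_forall_notMem hB),
    hN.measureReal_forall_notMem hB hb]
  linarith [Real.add_one_le_exp (-μ.real B)]

theorem measureReal_nontrivial_le (hB : MeasurableSet B) (hb : Bornology.IsBounded B) :
    P.real {ω | {i | x ω i ∈ B}.Nontrivial} ≤ μ.real B ^ 2 := by
  have hcount := hN.measureReal_count_mem hB hb (measurableSet_Ioi (a := 1))
  have hone : (fun k : ℕ => (k : ℝ≥0∞)) ⁻¹' Ioi 1 = Ioi 1 := by ext k; simp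
  have hevent (ω : Ω) : {i | x ω i ∈ B}.Nontrivial ↔
      Measure.sum (fun i => Measure.dirac (x ω i)) B ∈ Ioi 1 := by
    rw [sum_dirac_apply _ hB, ← one_lt_encard_iff_nontrivial, mem_Ioi, ← ENat.toENNReal_one,
      ENat.toENNReal_lt]
  simp only [hevent]
  rw [hcount, hone]
  exact poissonMeasure_real_Ioi_one_le _

end PointProcess

section MarkedPoints

variable {E Ω : Type*} [PseudoMetricSpace E] [MeasurableSpace E] [MeasurableSpace Ω]
  {ν : Measure E} {P : Measure Ω} {ι : Ω → Type*} {Y : ∀ ω, ι ω → E} {U : ∀ ω, ι ω → ℝ≥0}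
  (hN : IsPoissonPointProcess (fun ω => Measure.sum fun i => Measure.dirac (Y ω i, U ω i))
    (ν.prod lebesgueHalfLine) P)
  {J : Type*} {A : J → Set E} {h : ℝ≥0} {L : ℕ}
include hN

theorem ae_ne_zero_of_mem [IsProbabilityMeasure P] {B : Set E} (hB : MeasurableSet B)
    (hb : Bornology.IsBounded B) : ∀ᵐ ω ∂P, ∀ i, Y ω i ∈ B → U ω i ≠ 0 := by
  have hle := hN.measureReal_exists_mem_le (hB.prod (measurableSet_singleton (0 : ℝ≥0)))
    (hb.prod Bornology.isBounded_singleton)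
  rw [measureReal_prod_prod, measureReal_def lebesgueHalfLine, lebesgueHalfLine_singleton,
    ENNReal.toReal_zero, mul_zero] at hle
  have hnull := (measureReal_eq_zero_iff).1 (hle.antisymm measureReal_nonneg)
  filter_upwards [measure_eq_zero_iff_ae_notMem.1 hnull] with ω hω i hi h0
  exact hω ⟨i, hi, h0⟩

theorem measurable_occupiedCells (hA : ∀ j, MeasurableSet (A j)) :
    Measurable fun ω => occupiedCells A h L (Y ω) (U ω) := by
  refine measurable_set_iff.2 fun s => measurableSet_setOfPred.1 ?_
  have hvoid := hN.measurableSet_forall_notMem ((hA s.1).prod (measurableSet_timeSlab h s.2))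
  simpa [occupiedCells, compl_ofPred] using hvoid.compl

theorem measureReal_occupiedCells_subset (hν : BoundedlyFinite ν) {S : Set (J × Fin L)}
    (hm : ∀ l, MeasurableSet (excludedUnion A S l))
    (hb : ∀ l, Bornology.IsBounded (excludedUnion A S l)) :
    P.real {ω | occupiedCells A h L (Y ω) (U ω) ⊆ S} =
      ∏ l, Real.exp (-(ν.real (excludedUnion A S l) * h)) := by
  set R : Fin L → Set (E × ℝ≥0) := fun l => excludedUnion A S l ×ˢ timeSlab h l with hR
  have hRm (l : Fin L) : MeasurableSet (R l) := (hm l).prod (measurableSet_timeSlab h l)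
  have hRb (l : Fin L) : Bornology.IsBounded (R l) := (hb l).prod (isBounded_timeSlab h l)
  have hRdisj : Pairwise (Function.onFun Disjoint R) := fun l l' hl =>
    disjoint_prod.2 (.inr (pairwise_disjoint_timeSlab h (Fin.val_injective.ne hl)))
  have hRfin (l : Fin L) : ν.prod lebesgueHalfLine (R l) ≠ ∞ := by
    rw [Measure.prod_prod, lebesgueHalfLine_timeSlab]
    exact ENNReal.mul_ne_top (hν _ (hm l) (hb l)).ne ENNReal.coe_ne_top
  have hevent : {ω | occupiedCells A h L (Y ω) (U ω) ⊆ S} =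
      {ω | ∀ i, (Y ω i, U ω i) ∉ ⋃ l, R l} := by
    ext ω
    simp only [mem_ofPred_eq, occupiedCells_subset_iff, hR, mem_iUnion, not_exists, mem_prod,
      not_and']
    exact forall_comm
  rw [hevent, hN.measureReal_forall_notMem (.iUnion hRm) (Bornology.isBounded_iUnion.2 hRb),
    measureReal_iUnion_fintype hRdisj hRm hRfin, ← Real.exp_sum, Finset.sum_neg_distrib]
  simp only [hR, measureReal_prod_timeSlab]

theorem measureReal_not_isSimpleOccupancy_le [IsProbabilityMeasure P] {κ : Type*}
    {A : Option κ → Set E} (hA : Pairwise (Function.onFun Disjoint A))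
    (hm : MeasurableSet (A none)) {C : Set E} (hAC : ∀ j, A j ⊆ C) (hCm : MeasurableSet C)
    (hCb : Bornology.IsBounded C) :
    P.real {ω | ¬ IsSimpleOccupancy (occupiedCells A h L (Y ω) (U ω))} ≤
      L * (ν.real (A none) * h + (ν.real C * h) ^ 2) := by
  have hslab (l : Fin L) :
      P.real ({ω | ∃ i, (Y ω i, U ω i) ∈ A none ×ˢ timeSlab h l} ∪
        {ω | {i | (Y ω i, U ω i) ∈ C ×ˢ timeSlab h l}.Nontrivial}) ≤
      ν.real (A none) * h + (ν.real C * h) ^ 2 := by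
    rw [← measureReal_prod_timeSlab ν _ h l, ← measureReal_prod_timeSlab ν _ h l]
    exact (measureReal_union_le _ _).trans (add_le_add
      (hN.measureReal_exists_mem_le (hm.prod (measurableSet_timeSlab h l))
        ((hCb.subset (hAC _)).prod (isBounded_timeSlab h l)))
      (hN.measureReal_nontrivial_le (hCm.prod (measurableSet_timeSlab h l))
        (hCb.prod (isBounded_timeSlab h l))))
  calc P.real {ω | ¬ IsSimpleOccupancy (occupiedCells A h L (Y ω) (U ω))}
      ≤ P.real (⋃ l : Fin L, {ω | ∃ i, (Y ω i, U ω i) ∈ A none ×ˢ timeSlab h l} ∪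
          {ω | {i | (Y ω i, U ω i) ∈ C ×ˢ timeSlab h l}.Nontrivial}) :=
        measureReal_mono fun ω hω => mem_iUnion.2 <|
          exists_mem_or_nontrivial_of_not_isSimpleOccupancy hA hAC hω
    _ ≤ ∑ _ : Fin L, (ν.real (A none) * h + (ν.real C * h) ^ 2) :=
        (measureReal_iUnion_fintype_le _).trans (Finset.sum_le_sum fun l _ => hslab l)
    _ = L * (ν.real (A none) * h + (ν.real C * h) ^ 2) := by
        rw [Finset.sum_const, Finset.card_univ, Fintype.card_fin, nsmul_eq_mul]

end MarkedPoints

end IsPoissonPointProcess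

/-! ### Discretization of the two processes -/

section Mesh

variable {T : Type*} [MetricSpace T] [CompactSpace T]

theorem exists_mesh {K δ : ℝ≥0} (hK : 0 < K) (hδ : 0 < δ) (c : ℝ) :
    ∃ (L : ℕ) (h : ℝ≥0), 0 < h ∧ L * h = K ∧ 2 * h ≤ δ ∧ L * (c * h) ^ 2 ≤ δ := by
  have hmesh := (tendsto_const_div_atTop_nhds_zero_nat (2 * K : ℝ)).eventually_le_const
    (NNReal.coe_pos.2 hδ)
  have hpair := (tendsto_const_div_atTop_nhds_zero_nat ((c * K) ^ 2)).eventually_le_const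
    (NNReal.coe_pos.2 hδ)
  obtain ⟨L, h₁, h₂, hL⟩ := (hmesh.and (hpair.and (eventually_ne_atTop 0))).exists
  have hL₀ : (L : ℝ≥0) ≠ 0 := Nat.cast_ne_zero.2 hL
  refine ⟨L, K / L, div_pos hK (pos_iff_ne_zero.2 hL₀), mul_div_cancel₀ _ hL₀, ?_, ?_⟩
  · rw [← mul_div_assoc]
    exact_mod_cast h₁
  · refine le_of_eq_of_le ?_ h₂
    have hL_ne : (L : ℝ) ≠ 0 := Nat.cast_ne_zero.2 hL
    push_cast
    field_simp

theorem measurableSet_le_supNorm (ε : ℝ≥0) : MeasurableSet {w : CPlus T | ε ≤ supNorm w} :=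
  (isClosed_le continuous_const continuous_supNorm).measurableSet

theorem exists_supNorm_continuityPartition {ν : Measure (CPlus T)}
    (hν : ∀ ε : ℝ≥0, 0 < ε → ν {w | ε ≤ supNorm w} ≠ ∞) {δ : ℝ≥0} (hδ : 0 < δ) {η : ℝ}
    (hη : 0 < η) :
    ∃ ε : ℝ≥0, 0 < ε ∧ ε ≤ δ ∧ ∃ (k : ℕ) (p : ContinuityPartition ν {w | ε ≤ supNorm w} δ (Fin k)),
      ν.real (p.cell none) ≤ η := by
  obtain ⟨r, ⟨hr, hrδ⟩, hfr⟩ := exists_level_null_frontier (ν := ν)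
    (NNReal.continuous_coe.comp continuous_supNorm) (NNReal.coe_lt_coe.2 (half_lt_self hδ))
    (by simpa only [Function.comp_apply, NNReal.coe_le_coe] using hν _ (half_pos hδ))
  lift r to ℝ≥0 using (NNReal.coe_nonneg _).trans hr.le
  have hε : 0 < r := (half_pos hδ).trans (NNReal.coe_lt_coe.1 hr)
  simp only [Function.comp_apply, NNReal.coe_le_coe] at hfr
  obtain ⟨k, p, hp⟩ := exists_continuityPartition
    (measurableSet_le_supNorm r) (hν r hε) hfr (NNReal.coe_pos.2 hδ) (ENNReal.ofReal_pos.2 hη)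
  exact ⟨r, hε, (NNReal.coe_lt_coe.1 hrδ).le, k, p, ENNReal.toReal_le_of_le_ofReal hη.le hp⟩

theorem exists_continuityPartition_mesh {ν : Measure (CPlus T)}
    (hν : ∀ ε : ℝ≥0, 0 < ε → ν {w | ε ≤ supNorm w} ≠ ∞) {K δ : ℝ≥0} (hK : 0 < K) (hδ : 0 < δ) :
    ∃ ε : ℝ≥0, 0 < ε ∧ ε ≤ δ ∧
      ∃ (k : ℕ) (p : ContinuityPartition ν {w | ε ≤ supNorm w} δ (Fin k)) (L : ℕ) (h : ℝ≥0),
        0 < h ∧ L * h = K ∧ 2 * h ≤ δ ∧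
        L * (ν.real (p.cell none) * h + (ν.real {w | ε ≤ supNorm w} * h) ^ 2) < δ := by
  have hη : (0 : ℝ) < δ / (3 * K) := by positivity
  obtain ⟨ε, hε, hεδ, k, p, hp⟩ := exists_supNorm_continuityPartition hν hδ hη
  obtain ⟨L, h, hh, rfl, h2, hpair⟩ :=
    exists_mesh hK (div_pos hδ three_pos) (ν.real {w | ε ≤ supNorm w})
  refine ⟨ε, hε, hεδ, k, p, L, h, hh, rfl, h2.trans (div_le_self zero_le (by norm_num)), ?_⟩
  rw [le_div_iff₀ (by positivity)] at hp
  push_cast at hp hpair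
  have : (0 : ℝ) < δ := hδ
  linarith

end Mesh

section Points

variable {T : Type*} [MetricSpace T] [CompactSpace T] {ν : Measure (ExtCone T)}

open ExtCone

theorem BoundedlyFinite.map_unpolar_ne_top (hν : BoundedlyFinite ν) {ε : ℝ≥0} (hε : 0 < ε) :
    ν.map unpolar {w | ε ≤ supNorm w} ≠ ∞ := by
  have hm := measurableSet_le_supNorm (T := T) ε
  rw [Measure.map_apply measurable_unpolar hm]
  exact (hν _ (measurable_unpolar hm) (isBounded_unpolar_preimage hε fun _ hw => hw)).ne

namespace IsPoissonPointProcess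

variable {Ω : Type*} [MeasurableSpace Ω] {P : Measure Ω} {ι : Ω → Type*}
  {Y : ∀ ω, ι ω → CPlusZero T} {U : ∀ ω, ι ω → ℝ≥0}
  (hN : IsPoissonPointProcess
    (fun ω => Measure.sum fun i => Measure.dirac (polar (Y ω i), U ω i))
    (ν.prod lebesgueHalfLine) P)
  {J : Type*} {A : J → Set (CPlus T)} {h : ℝ≥0} {L : ℕ} {ε : ℝ≥0}
include hN

theorem locallyFinitePoints (ω : Ω) : LocallyFinitePoints (fun i => (Y ω i).1) (U ω) := by
  intro ε hε K
  have hm := measurableSet_le_supNorm (T := T) ε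
  have hfin := hN.finite_mem ((measurable_unpolar hm).prod measurableSet_Icc)
    ((isBounded_unpolar_preimage hε fun _ hw => hw).prod (Metric.isBounded_Icc 0 K)) ω
  simpa only [mem_prod, mem_preimage, unpolar_polar, mem_ofPred_eq, mem_Icc, zero_le, true_and]
    using hfin

theorem ae_pos_of_le_supNorm [IsProbabilityMeasure P] (hε : 0 < ε) :
    ∀ᵐ ω ∂P, ∀ i, ε ≤ supNorm (Y ω i).1 → 0 < U ω i := by
  have hm := measurableSet_le_supNorm (T := T) ε
  filter_upwards [hN.ae_ne_zero_of_mem (measurable_unpolar hm)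
    (isBounded_unpolar_preimage hε fun _ hw => hw)] with ω hω i hi
  exact pos_iff_ne_zero.2 (hω i (by rwa [mem_preimage, unpolar_polar]))

theorem measurable_occupiedCells_polar (hA : ∀ j, MeasurableSet (A j)) :
    Measurable fun ω => occupiedCells A h L (fun i => (Y ω i).1) (U ω) := by
  simpa only [occupiedCells_preimage, unpolar_polar] using
    hN.measurable_occupiedCells fun j => measurable_unpolar (hA j)

theorem measureReal_occupiedCells_polar_subset [Countable J] (hν : BoundedlyFinite ν)
    (hA : ∀ j, MeasurableSet (A j)) (hε : 0 < ε) (hAε : ∀ j, A j ⊆ {w | ε ≤ supNorm w})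
    (S : Set (J × Fin L)) :
    P.real {ω | occupiedCells A h L (fun i => (Y ω i).1) (U ω) ⊆ S} =
      ∏ l, Real.exp (-((ν.map unpolar).real (excludedUnion A S l) * h)) := by
  have hm := measurableSet_excludedUnion hA S
  have hvoid := hN.measureReal_occupiedCells_subset (A := fun j => unpolar ⁻¹' A j) (h := h)
    (S := S) hν (fun l => excludedUnion_preimage unpolar A S l ▸ measurable_unpolar (hm l))
    fun l => excludedUnion_preimage unpolar A S l ▸
      isBounded_unpolar_preimage hε (excludedUnion_subset hAε S l)
  simpa only [occupiedCells_preimage, excludedUnion_preimage, unpolar_polar,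
    map_measureReal_apply measurable_unpolar (hm _)] using hvoid

theorem measureReal_not_isSimpleOccupancy_polar_le [IsProbabilityMeasure P] {δ : ℝ} {κ : Type*}
    (p : ContinuityPartition (ν.map unpolar) {w | ε ≤ supNorm w} δ κ) (hε : 0 < ε) :
    P.real {ω | ¬ IsSimpleOccupancy (occupiedCells p.cell h L (fun i => (Y ω i).1) (U ω))} ≤
      L * ((ν.map unpolar).real (p.cell none) * h +
        ((ν.map unpolar).real {w | ε ≤ supNorm w} * h) ^ 2) := by
  have hm := measurableSet_le_supNorm (T := T) ε
  have hbad := hN.measureReal_not_isSimpleOccupancy_le (h := h) (L := L)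
    (A := fun j => unpolar ⁻¹' p.cell j) (fun j j' hne => (p.disjoint_cell hne).preimage _)
    (measurable_unpolar (p.measurableSet_cell _)) (fun j => preimage_mono (p.cell_subset j))
    (measurable_unpolar hm) (isBounded_unpolar_preimage hε fun _ hw => hw)
  simpa only [occupiedCells_preimage, unpolar_polar,
    map_measureReal_apply measurable_unpolar (p.measurableSet_cell _),
    map_measureReal_apply measurable_unpolar hm] using hbad

end IsPoissonPointProcess

variable {Ω : ℕ → Type*} [∀ n, MeasurableSpace (Ω n)] {P : ∀ n, Measure (Ω n)}
  [∀ n, IsProbabilityMeasure (P n)] {X : ∀ n, ℕ → Ω n → CPlus T}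
  (hX : ∀ n i, AEMeasurable (X n i) (P n)) (hindep : ∀ n, iIndepFun (X n) (P n))
  {μ : ℕ → Measure (CPlus T)} (hlaw : ∀ n i, (P n).map (X n i) = μ n)
  (hconv : SharpWeakTendsto (fun n => (n : ℝ≥0∞) • inducedMeasure (μ n)) ν)
  (hν : ν {p | p.radius = ∞} = 0)
  {Ω' : Type*} [MeasurableSpace Ω'] {P' : Measure Ω'} [IsProbabilityMeasure P']
  {ι : Ω' → Type*} {Y : ∀ ω, ι ω → CPlusZero T} {U : ∀ ω, ι ω → ℝ≥0}
  (hN : IsPoissonPointProcess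
    (fun ω => Measure.sum fun i => Measure.dirac (polar (Y ω i), U ω i))
    (ν.prod lebesgueHalfLine) P')
include hX hindep hlaw hconv hν hN

theorem tendsto_measureReal_occupiedCells_eq {ε : ℝ≥0} (hε : 0 < ε) {δ : ℝ} {κ : Type*} [Finite κ]
    (p : ContinuityPartition (ν.map unpolar) {w | ε ≤ supNorm w} δ κ) (h : ℝ≥0) (L : ℕ)
    (S : Set (Option κ × Fin L)) :
    Tendsto (fun n => (P n).real
      {ω | occupiedCells p.cell h L (fun i => X n i ω) (entryTime n) = S}) atTop
      (𝓝 (P'.real {ω | occupiedCells p.cell h L (fun i => (Y ω i).1) (U ω) = S})) := by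
  refine tendsto_measureReal_eq_of_subset
    (fun n => aemeasurable_occupiedCells (hX n) p.measurableSet_cell h L (entryTime n))
    (hN.measurable_occupiedCells_polar p.measurableSet_cell).aemeasurable (fun S => ?_) S
  rw [hN.measureReal_occupiedCells_polar_subset hconv.boundedlyFinite_limit p.measurableSet_cell
    hε p.cell_subset]
  have hm := measurableSet_excludedUnion p.measurableSet_cell S
  exact tendsto_measureReal_occupiedCells_subset hX hindep hlaw hm fun l =>
    tendsto_mul_measureReal hconv hν (hm l) hε (excludedUnion_subset p.cell_subset S l)
      (null_frontier_biUnion p.measure_frontier_cell (toFinite _))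

theorem exists_tendstoInDistribution_mem_basicNhd {M : ∀ n, Ω n → SkorokhodSpace (CPlus T)}
    {M' : Ω' → SkorokhodSpace (CPlus T)}
    (hM : ∀ n, n ≠ 0 → ∀ ω, IsSupPath (fun i => X n i ω) (entryTime n) (M n ω))
    (hM' : ∀ ω, IsSupPath (fun i => (Y ω i).1) (U ω) (M' ω))
    (K : ℝ≥0) {δ : ℝ≥0} (hδ : 0 < δ) :
    ∃ (Z : ∀ n, Ω n → SkorokhodSpace (CPlus T)) (Z' : Ω' → SkorokhodSpace (CPlus T)),
      TendstoInDistribution Z atTop Z' P P' ∧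
      (∀ᶠ n in atTop, (P n).real {ω | M n ω ∉ (Z n ω).basicNhd K δ} ≤ δ) ∧
      P'.real {ω | M' ω ∉ (Z' ω).basicNhd K δ} ≤ δ := by
  obtain ⟨ε, hε, hεδ, k, p, L, h, hh, hLh, h2, hbad⟩ := exists_continuityPartition_mesh
    (fun ε hε => hconv.boundedlyFinite_limit.map_unpolar_ne_top hε) (K := K + 1) (by positivity) hδ
  replace hbad := (hN.measureReal_not_isSimpleOccupancy_polar_le p hε).trans_lt hbad
  choose z hz using exists_isPrototype (L := L) p.center h
  have hξ (n : ℕ) := aemeasurable_occupiedCells (hX n) p.measurableSet_cell h L (entryTime n)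
  have hξ' := (hN.measurable_occupiedCells_polar (h := h) (L := L)
    p.measurableSet_cell).aemeasurable (μ := P')
  have hlim := tendsto_measureReal_occupiedCells_eq hX hindep hlaw hconv hν hN hε p h L
  have hK_le : K ≤ L * h := hLh ▸ le_self_add
  have hδ_max : max (δ : ℝ) (2 * h) ≤ δ := max_le le_rfl (by exact_mod_cast h2)
  refine ⟨_, _, tendstoInDistribution_comp_of_finite hξ hξ' hlim z, ?_, ?_⟩
  · have hsimple := tendsto_measureReal_comp_of_finite hξ hξ' hlim (¬ IsSimpleOccupancy ·)
    filter_upwards [hsimple.eventually_le_const hbad, eventually_ne_atTop 0] with n hn hn0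
    refine (measureReal_mono fun ω => mt fun hS => ?_).trans hn
    exact SkorokhodSpace.basicNhd_anti _ hK_le hδ_max ((hz _).mem_basicNhd (hM n hn0 ω) hS
      (locallyFinitePoints_entryTime hn0 _) hε hεδ hh fun i _ => by
        rw [entryTime]; positivity)
  · refine (ENNReal.toReal_mono (measure_ne_top _ _) (measure_mono_ae ?_)).trans hbad.le
    filter_upwards [hN.ae_pos_of_le_supNorm hε] with ω hU
    refine mt fun hS => ?_
    exact SkorokhodSpace.basicNhd_anti _ hK_le hδ_max ((hz _).mem_basicNhd (hM' ω) hS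
      (hN.locallyFinitePoints ω) hε hεδ hh hU)

end Points

theorem theorem2 {T : Type*} [MetricSpace T] [CompactSpace T]
    -- for each `n`, the process `X n` and its independent copies `Xc n 0`, `Xc n 1`, …
    {Ω₀ : ℕ → Type*} [∀ n, MeasurableSpace (Ω₀ n)] (P₀ : ∀ n, Measure (Ω₀ n))
    [∀ n, IsProbabilityMeasure (P₀ n)] (X : ∀ n, Ω₀ n → CPlus T)
    {Ω : ℕ → Type*} [∀ n, MeasurableSpace (Ω n)] (P : ∀ n, Measure (Ω n))
    [∀ n, IsProbabilityMeasure (P n)] (Xc : ∀ n, ℕ → Ω n → CPlus T)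
    (hcopy : ∀ n i, IdentDistrib (Xc n i) (X n) (P n) (P₀ n))
    (hindep : ∀ n, iIndepFun (Xc n) (P n))
    -- `n ℙ[X_n ∈ ·]` converges to `ν`, which does not charge the points with infinite radius
    (ν : Measure (ExtCone T))
    (hconv : SharpWeakTendsto
      (fun n => (n : ℝ≥0∞) • ExtCone.inducedMeasure ((P₀ n).map (X n))) ν)
    (hν : ν {p | p.radius = ∞} = 0)
    -- a Poisson point process `∑ δ_(Y_i, U_i)` on `C₀⁺ × [0,∞)` with intensity `ν ⊗ Lebesgue`;
    -- the index set may be random, so as to allow finitely many points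
    {Ω' : Type*} [MeasurableSpace Ω'] (P' : Measure Ω') [IsProbabilityMeasure P']
    (I : Ω' → Set ℕ) (Y : ∀ ω, I ω → CPlusZero T) (U : ∀ ω, I ω → ℝ≥0)
    (hPoisson : IsPoissonPointProcess
      (fun ω => Measure.sum (fun i : I ω => Measure.dirac (ExtCone.polar (Y ω i), U ω i)))
      (ν.prod lebesgueHalfLine) P') :
    -- the maxima define processes with paths in the Skorokhod space, and these converge weakly
    ∃ (M : ∀ n, Ω n → SkorokhodSpace (CPlus T)) (M' : Ω' → SkorokhodSpace (CPlus T)),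
      (∀ n ω u t, M n ω u t =
        (Finset.range ⌊(n : ℝ≥0) * u⌋₊).sup (fun i => Xc n i ω t)) ∧
      (∀ ω u t, IsLUB
        (Set.range (fun i : I ω => (Set.Ici (U ω i)).indicator (fun _ => (Y ω i).1 t) u))
        (M' ω u t)) ∧
      TendstoInDistribution M atTop M' P P' := by
  have hXm (n i) : AEMeasurable (Xc n i) (P n) := (hcopy n i).aemeasurable_fst
  choose Φ hΦ using fun n => exists_maximaPath (T := T) n
  choose M' hM' using fun ω => (hPoisson.locallyFinitePoints ω).exists_isSupPath
  refine ⟨fun n ω => Φ n fun i => Xc n i ω, M', fun n ω => hΦ n fun i => Xc n i ω,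
    fun ω u t => isLUB_range_indicator_iff.2 (hM' ω u t), ?_⟩
  refine SkorokhodSpace.tendstoInDistribution_of_approx
    (fun n => (continuous_maximaPath (hΦ n)).measurable.comp_aemeasurable
      (aemeasurable_pi_lambda _ (hXm n))) fun K ε hε => ?_
  lift ε to ℝ≥0 using hε.le
  exact exists_tendstoInDistribution_mem_basicNhd hXm hindep (fun n i => (hcopy n i).map_eq)
    hconv hν hPoisson (fun n hn ω => (isSupPath_entryTime_iff hn).2 (hΦ n _)) hM' K hε
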